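/- Let $\mathbf{M}$ be a complete and cocomplete closed symmetric monoidal category with tensor product $\otimes$ and unit $I$. An orthogonal category $\overline{\mathbf{D}}=(\mathbf{D},\perp)$ is a small category $\mathbf{D}$ with a relation $\perp$ on pairs of morphisms with common target that is symmetric and stable under composition: if $f_1\perp f_2$, then $g f_1 h_1\perp g f_2 h_2$ for all composable $g,h_1,h_2$. The coloured operad $\mathcal{O}_{\overline{\mathbf{D}}}$ (in sets) has the objects of $\mathbf{D}$ as colours and the operations $$\mathcal{O}_{\overline{\mathbf{D}}}\binom{t}{(c_1,\dots,c_n)}=\Big(\Sigma_n\times\prod_{i=1}^n\mathbf{D}(c_i,t)\Big)\Big/\sim ,$$ where $(\sigma,\underline f)\sim(\sigma',\underline f')$ if and only if $\underline f=\underline f'$ and the sequence $\underline f\sigma^{-1}=(f_{\sigma^{-1}(1)},\dots,f_{\sigma^{-1}(n)})$ is carried to $\underline f\sigma'^{-1}$ by writing the right permutation $\sigma\sigma'^{-1}$ as a finite product of transpositions of adjacent orthogonal pairs. The symmetric groups act by $[\sigma,\underline f]\,\sigma'=[\sigma\sigma',\underline f\sigma']$, the unit at $t$ is $[e,\mathrm{id}_t]$,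 and the composition is $$\gamma\big([\sigma,\underline f];[\sigma_1,\underline g_1],\dots,[\sigma_m,\underline g_m]\big)=\big[\sigma(\sigma_1,\dots,\sigma_m),(f_1g_{11},\dots,f_1g_{1k_1},\dots,f_mg_{m1},\dots,f_mg_{mk_m})\big],$$ where $\sigma(\sigma_1,\dots,\sigma_m)$ applies $\sigma_i$ in the $i$-th block and permutes the blocks by $\sigma$. Write $\mathbf{Alg}(\mathcal{O}_{\overline{\mathbf{D}}})$ for the category of $\mathbf{M}$-valued algebras over this operad, a set $S$ of operations being regarded as the object $\coprod_{S}I$ of $\mathbf{M}$. Let $j:\mathbf{C}\to\mathbf{D}$ be a fully faithful functor between small categories that is injective on objects, let $\overline{\mathbf{C}}=(\mathbf{C},j^*(\perp))$, where $f_1\mathrel{j^*(\perp)}f_2$ if and only if $j(f_1)\perp j(f_2)$, and let $\mathcal{O}_j^*:\mathbf{Alg}(\mathcal{O}_{\overline{\mathbf{D}}})\to\mathbf{Alg}(\mathcal{O}_{\overline{\mathbf{C}}})$ be the pullback of algebras along the operad morphism $\mathcal{O}_j:\mathcal{O}_{\overline{\mathbf{C}}}\to\mathcal{O}_{\overline{\mathbf{D}}}$,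 $[\sigma,\underline f]\mapsto[\sigma,j(\underline f)]$. Then $\mathcal{O}_j^*$ has a left adjoint. For every left adjoint $\mathcal{O}_{j!}$ of $\mathcal{O}_j^*$, with unit $\eta$ and counit $\varepsilon$ of the adjunction $\mathcal{O}_{j!}\dashv\mathcal{O}_j^*$, the following hold. Call $A\in\mathbf{Alg}(\mathcal{O}_{\overline{\mathbf{D}}})$ *$j$-local* if $\varepsilon_A:\mathcal{O}_{j!}\mathcal{O}_j^*(A)\to A$ is an isomorphism. 1. The unit $\eta:\mathrm{id}_{\mathbf{Alg}(\mathcal{O}_{\overline{\mathbf{C}}})}\to\mathcal{O}_j^*\mathcal{O}_{j!}$ is a natural isomorphism. 2. For every $B\in\mathbf{Alg}(\mathcal{O}_{\overline{\mathbf{C}}})$, the algebra $\mathcal{O}_{j!}(B)$ is $j$-local. 3. The adjunction $\mathcal{O}_{j!}\dashv\mathcal{O}_j^*$ restricts to an adjoint equivalence between $\mathbf{Alg}(\mathcal{O}_{\overline{\mathbf{C}}})$ and the full subcategory of $j$-local objects of $\mathbf{Alg}(\mathcal{O}_{\overline{\mathbf{D}}})$. -/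

import Mathlib

open CategoryTheory CategoryTheory.Limits MonoidalCategory

universe v u

namespace OrthQFT

/-! ### Orthogonal categories -/

/-- An orthogonality relation on a category `C`: a symmetric relation on pairs of morphisms with
common target, stable under post-composition and under pre-composition. -/
structure OrthRel (C : Type v) [SmallCategory C] where
  rel : ∀ {c₁ c₂ t : C}, (c₁ ⟶ t) → (c₂ ⟶ t) → Prop
  symm : ∀ {c₁ c₂ t : C} {f₁ : c₁ ⟶ t} {f₂ : c₂ ⟶ t}, rel f₁ f₂ → rel f₂ f₁
  postcomp : ∀ {c₁ c₂ t t' : C} {f₁ : c₁ ⟶ t} {f₂ : c₂ ⟶ t} (g : t ⟶ t'),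
    rel f₁ f₂ → rel (f₁ ≫ g) (f₂ ≫ g)
  precomp : ∀ {b₁ b₂ c₁ c₂ t : C} {f₁ : c₁ ⟶ t} {f₂ : c₂ ⟶ t} (h₁ : b₁ ⟶ c₁) (h₂ : b₂ ⟶ c₂),
    rel f₁ f₂ → rel (h₁ ≫ f₁) (h₂ ≫ f₂)

/-- The pullback `F^*(⊥)` of an orthogonality relation along a functor. -/
def OrthRel.pullback {C D : Type v} [SmallCategory C] [SmallCategory D]
    (perp : OrthRel D) (F : C ⥤ D) : OrthRel C where
  rel f₁ f₂ := perp.rel (F.map f₁) (F.map f₂)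
  symm h := perp.symm h
  postcomp g h := by
    simpa only [F.map_comp] using perp.postcomp (F.map g) h
  precomp h₁ h₂ h := by
    simpa only [F.map_comp] using perp.precomp (F.map h₁) (F.map h₂) h

/-- `F : (C, ⊥_C) → (D, ⊥_D)` is an orthogonal functor. -/
def IsOrthFunctor {C D : Type v} [SmallCategory C] [SmallCategory D]
    (perpC : OrthRel C) (perpD : OrthRel D) (F : C ⥤ D) : Prop :=
  ∀ {c₁ c₂ t : C} (f₁ : c₁ ⟶ t) (f₂ : c₂ ⟶ t),
    perpC.rel f₁ f₂ → perpD.rel (F.map f₁) (F.map f₂)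

lemma isOrthFunctor_pullback {C D : Type v} [SmallCategory C] [SmallCategory D]
    (perp : OrthRel D) (F : C ⥤ D) : IsOrthFunctor (perp.pullback F) perp F :=
  fun _ _ h => h

/-! ### The coloured operad of an orthogonal category

Profiles of colours are finite sequences `c : Fin n → C` of objects. -/

section Operad

variable {C : Type v} [SmallCategory C]

/-- The profile `b₁ ⊗ ⋯ ⊗ bₘ` obtained by concatenating the profiles `bᵢ`. -/
def concat {m : ℕ} {k : Fin m → ℕ} (b : ∀ i, Fin (k i) → C) : Fin (∑ i, k i) → C :=
  fun x => b (finSigmaFinEquiv.symm x).1 (finSigmaFinEquiv.symm x).2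

/-- The set `O_C(t; c) = Σₙ × ∏ᵢ C(cᵢ, t)`, whose elements are pairs `(σ, f)`. -/
@[ext]
structure PreOp {n : ℕ} (c : Fin n → C) (t : C) : Type v where
  perm : Equiv.Perm (Fin n)
  hom : ∀ i, c i ⟶ t

namespace PreOp

/-- The right action `(σ, f) ↦ (σ σ', f σ')` of the symmetric group. -/
def permute {n : ℕ} {c : Fin n → C} {t : C} (σ' : Equiv.Perm (Fin n)) (o : PreOp c t) :
    PreOp (c ∘ σ') t where
  perm := o.perm * σ'
  hom i := o.hom (σ' i)

/-- The operadic unit `(e, id_t)`. -/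
def one (t : C) : PreOp (fun _ : Fin 1 => t) t where
  perm := 1
  hom _ := 𝟙 t

/-- The permutation `σ(σ₁, …, σₘ) = σ⟨k_{σ⁻¹(1)}, …, k_{σ⁻¹(m)}⟩ (σ₁ ⊕ ⋯ ⊕ σₘ)`: the entry `j` of
the block `i` is sent to the entry `σᵢ(j)` of the block `σ(i)`, the blocks having sizes
`k₁, …, kₘ` in the source and `k_{σ⁻¹(1)}, …, k_{σ⁻¹(m)}` in the target. -/
def blockPerm {m : ℕ} (σ : Equiv.Perm (Fin m)) {k : Fin m → ℕ}
    (τ : ∀ i, Equiv.Perm (Fin (k i))) : Equiv.Perm (Fin (∑ i, k i)) :=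
  finSigmaFinEquiv.symm.trans <|
    (Equiv.sigmaCongrRight τ).trans <|
      (Equiv.sigmaCongrLeft' σ).trans <|
        finSigmaFinEquiv.trans (finCongr (Equiv.sum_comp σ.symm k))

/-- The operadic composition
`γ((σ, f); (σ₁, g₁), …, (σₘ, gₘ)) = (σ(σ₁, …, σₘ), f(g₁, …, gₘ))`. -/
def comp {m : ℕ} {a : Fin m → C} {t : C} (o : PreOp a t) {k : Fin m → ℕ}
    {b : ∀ i, Fin (k i) → C} (p : ∀ i, PreOp (b i) (a i)) : PreOp (concat b) t where
  perm := blockPerm o.perm fun i => (p i).perm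
  hom x := (p (finSigmaFinEquiv.symm x).1).hom (finSigmaFinEquiv.symm x).2 ≫
    o.hom (finSigmaFinEquiv.symm x).1

/-- Transposition of an adjacent orthogonal pair: in the sequence
`f σ⁻¹ = (f_{σ⁻¹(1)}, …, f_{σ⁻¹(n)})` the entries at two adjacent positions `p`, `p + 1` are
orthogonal, and `σ'⁻¹ = σ⁻¹ τ` with `τ` the transposition of `p` and `p + 1`. -/
def Step (perp : OrthRel C) {n : ℕ} {c : Fin n → C} {t : C} (o o' : PreOp c t) : Prop :=
  o.hom = o'.hom ∧ ∃ p q : Fin n, p.val + 1 = q.val ∧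
    perp.rel (o.hom (o.perm.symm p)) (o.hom (o.perm.symm q)) ∧
    o'.perm.symm = o.perm.symm * Equiv.swap p q

/-- The equivalence relation `(σ, f) ∼ (σ', f')`: one has `f = f'`, and the right permutation
`σ σ'⁻¹ : f σ⁻¹ → f σ'⁻¹` is a product of finitely many (possibly zero) transpositions of adjacent
orthogonal pairs. -/
def Sim (perp : OrthRel C) {n : ℕ} {c : Fin n → C} {t : C} : PreOp c t → PreOp c t → Prop :=
  Relation.ReflTransGen (Step perp)

lemma Step.symm {perp : OrthRel C} {n : ℕ} {c : Fin n → C} {t : C} {o o' : PreOp c t}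
    (h : Step perp o o') : Step perp o' o := by
  obtain ⟨hf, p, q, hpq, hr, hσ⟩ := h
  refine ⟨hf.symm, p, q, hpq, ?_, ?_⟩
  · rw [← hf, hσ, Equiv.Perm.mul_apply, Equiv.Perm.mul_apply, Equiv.swap_apply_left,
      Equiv.swap_apply_right]
    exact perp.symm hr
  · rw [hσ, mul_assoc, Equiv.swap_mul_self, mul_one]

lemma sim_equivalence (perp : OrthRel C) {n : ℕ} (c : Fin n → C) (t : C) :
    Equivalence (Sim perp (c := c) (t := t)) where
  refl _ := Relation.ReflTransGen.refl
  symm h := by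
    induction h with
    | refl => exact Relation.ReflTransGen.refl
    | tail _ h ih => exact Relation.ReflTransGen.head h.symm ih
  trans h h' := Relation.ReflTransGen.trans h h'

lemma Sim.hom_eq {perp : OrthRel C} {n : ℕ} {c : Fin n → C} {t : C} {o o' : PreOp c t}
    (h : Sim perp o o') : o.hom = o'.hom := by
  induction h with
  | refl => rfl
  | tail _ h ih => exact ih.trans h.1

lemma swap_lt {n : ℕ} {p q x y : Fin n} (hpq : p.val + 1 = q.val)
    (h : Equiv.swap p q x < Equiv.swap p q y) : x < y ∨ (x = q ∧ y = p) := by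
  rw [Equiv.swap_apply_def, Equiv.swap_apply_def] at h
  simp only [Fin.lt_def, Fin.ext_iff] at h ⊢
  split_ifs at h <;> omega

/-- Permutations that differ only in the order of orthogonal pairs give equivalent operations. -/
lemma sim_of_inversions {perp : OrthRel C} {n : ℕ} {c : Fin n → C} {t : C} {o o' : PreOp c t}
    (hf : o.hom = o'.hom)
    (h : ∀ i j, o.perm i < o.perm j → o'.perm j < o'.perm i → perp.rel (o.hom i) (o.hom j)) :
    Sim perp o o' := by
  classical
  obtain ⟨σ', f'⟩ := o'
  obtain ⟨σ, f⟩ := o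
  dsimp only at hf h
  subst hf
  let inv : Equiv.Perm (Fin n) → Finset (Fin n × Fin n) := fun σ =>
    Finset.univ.filter fun x => σ x.1 < σ x.2 ∧ σ' x.2 < σ' x.1
  have hinv : ∀ (σ : Equiv.Perm (Fin n)) (i j : Fin n),
      (i, j) ∈ inv σ ↔ σ i < σ j ∧ σ' j < σ' i := fun σ i j => by
    simp only [inv, Finset.mem_filter_univ]
  induction hN : (inv σ).card using Nat.strong_induction_on generalizing σ with
  | _ N ih =>
    by_cases hmono : ∀ p q : Fin n, p.val + 1 = q.val → σ' (σ.symm p) < σ' (σ.symm q)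
    · have hs : StrictMono (fun p => σ' (σ.symm p)) := by
        cases n with
        | zero => intro p; exact p.elim0
        | succ n =>
          rw [Fin.strictMono_iff_lt_succ]
          intro i
          exact hmono _ _ (by simp)
      have hid : ∀ p, σ' (σ.symm p) = p := by
        have hsurj : Function.Surjective (fun p => σ' (σ.symm p)) :=
          (σ.symm.trans σ').surjective
        intro p
        have := Subsingleton.elim (hs.orderIsoOfSurjective _ hsurj) (OrderIso.refl _)
        exact DFunLike.congr_fun this p
      have : σ = σ' := by
        ext i
        have := hid (σ i)
        rw [Equiv.symm_apply_apply] at this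
        rw [this]
      subst this
      exact Relation.ReflTransGen.refl
    · push Not at hmono
      obtain ⟨p, q, hpq, hle⟩ := hmono
      have hlt : σ' (σ.symm q) < σ' (σ.symm p) := by
        refine lt_of_le_of_ne hle fun he => ?_
        have := σ.symm.injective (σ'.injective he)
        rw [this] at hpq
        omega
      have hlt' : p < q := by rw [Fin.lt_def]; omega
      let σ₁ : Equiv.Perm (Fin n) := Equiv.swap p q * σ
      have hsub : ∀ x, x ∈ inv σ₁ → x ∈ inv σ := by
        rintro ⟨i, j⟩ hx
        rw [hinv] at hx ⊢
        refine ⟨?_, hx.2⟩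
        rcases swap_lt hpq hx.1 with h1 | ⟨h1, h2⟩
        · exact h1
        · exfalso
          rw [← h1, ← h2, Equiv.symm_apply_apply, Equiv.symm_apply_apply] at hlt
          exact absurd hlt (not_lt.mpr hx.2.le)
      have hss : inv σ₁ ⊂ inv σ := by
        refine Finset.ssubset_iff_subset_ne.mpr ⟨fun x => hsub x, fun he => ?_⟩
        have hm : (σ.symm p, σ.symm q) ∈ inv σ := by
          rw [hinv, Equiv.apply_symm_apply, Equiv.apply_symm_apply]
          exact ⟨hlt', hlt⟩
        rw [← he, hinv, Equiv.Perm.mul_apply, Equiv.Perm.mul_apply, Equiv.apply_symm_apply,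
          Equiv.apply_symm_apply, Equiv.swap_apply_left, Equiv.swap_apply_right] at hm
        exact absurd hm.1 (not_lt.mpr hlt'.le)
      refine Relation.ReflTransGen.head (b := ⟨σ₁, f⟩) ?_ ?_
      · refine ⟨rfl, p, q, hpq, ?_, ?_⟩
        · exact h _ _ (by simpa using hlt') hlt
        · rfl
      · refine ih _ ?_ σ₁ ?_ rfl
        · rw [← hN]
          exact Finset.card_lt_card hss
        · intro i j h1 h2
          have : (i, j) ∈ inv σ := hsub (i, j) ((hinv _ _ _).mpr ⟨h1, h2⟩)
          rw [hinv] at this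
          exact h _ _ this.1 this.2

/-- A single step only inverts the given orthogonal pair. -/
lemma Step.rel_of_inversion {perp : OrthRel C} {n : ℕ} {c : Fin n → C} {t : C}
    {o o' : PreOp c t} (h : Step perp o o') (i j : Fin n) (h₁ : o.perm i < o.perm j)
    (h₂ : o'.perm j < o'.perm i) : perp.rel (o.hom i) (o.hom j) := by
  obtain ⟨-, p, q, hpq, hr, hσ⟩ := h
  have hσ' : o'.perm = Equiv.swap p q * o.perm := by
    have := congrArg Equiv.symm hσ
    ext x
    have h3 : o'.perm x = (o'.perm.symm).symm x := rfl
    rw [h3, hσ]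
    rfl
  rw [hσ'] at h₂
  rcases swap_lt hpq h₂ with h3 | ⟨h3, h4⟩
  · exact absurd h₁ (not_lt.mpr h3.le)
  · rw [← h3, ← h4, Equiv.symm_apply_apply, Equiv.symm_apply_apply] at hr
    exact hr

lemma finSigma_lt {m : ℕ} {k : Fin m → ℕ} (x y : Σ i, Fin (k i)) :
    finSigmaFinEquiv x < finSigmaFinEquiv y ↔
      x.1 < y.1 ∨ (x.1 = y.1 ∧ x.2.val < y.2.val) := by
  have key : ∀ x y : Σ i, Fin (k i),
      (x.1 < y.1 ∨ (x.1 = y.1 ∧ x.2.val < y.2.val)) →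
        finSigmaFinEquiv x < finSigmaFinEquiv y := by
    rintro ⟨i, a⟩ ⟨i', a'⟩ h
    rw [Fin.lt_def, finSigmaFinEquiv_apply, finSigmaFinEquiv_apply]
    dsimp only at h ⊢
    rcases h with h | ⟨rfl, h⟩
    · have hs : ∀ i : Fin m, ∑ r : Fin i.val, k (Fin.castLE i.2.le r) =
          ∑ r ∈ Finset.Iio i, k r := by
        intro i
        refine Finset.sum_bij (fun r _ => Fin.castLE i.2.le r) ?_ ?_ ?_ ?_
        · intro r _
          exact Finset.mem_Iio.mpr r.2
        · intro r _ r' _ h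
          simpa [Fin.ext_iff] using h
        · intro r hr
          have hr' : r < i := Finset.mem_Iio.mp hr
          exact ⟨⟨r.val, hr'⟩, Finset.mem_univ _, rfl⟩
        · intro r _
          rfl
      rw [hs, hs]
      have h1 : ∑ r ∈ Finset.Iio i, k r + k i ≤ ∑ r ∈ Finset.Iio i', k r := by
        rw [add_comm, ← Finset.sum_insert (by simp)]
        refine Finset.sum_le_sum_of_subset ?_
        intro r hr
        rcases Finset.mem_insert.mp hr with rfl | hr
        · simpa using h
        · simpa using lt_trans (Finset.mem_Iio.mp hr) h
      have := a.2
      omega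
    · omega
  refine ⟨fun h => ?_, key x y⟩
  by_contra hc
  push Not at hc
  rcases lt_or_eq_of_le hc.1 with h1 | h1
  · exact absurd (key y x (Or.inl h1)) (not_lt.mpr h.le)
  · rcases lt_or_eq_of_le (hc.2 h1.symm) with h2 | h2
    · exact absurd (key y x (Or.inr ⟨h1, h2⟩)) (not_lt.mpr h.le)
    · have : x = y := by
        obtain ⟨i, a⟩ := x
        obtain ⟨i', a'⟩ := y
        dsimp only at h1 h2
        subst h1
        rw [Fin.ext h2.symm]
      rw [this] at h
      exact lt_irrefl _ h

lemma blockPerm_lt {m : ℕ} (σ : Equiv.Perm (Fin m)) {k : Fin m → ℕ}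
    (τ : ∀ i, Equiv.Perm (Fin (k i))) (x y : Fin (∑ i, k i)) :
    blockPerm σ τ x < blockPerm σ τ y ↔
      σ (finSigmaFinEquiv.symm x).1 < σ (finSigmaFinEquiv.symm y).1 ∨
      ((finSigmaFinEquiv.symm x).1 = (finSigmaFinEquiv.symm y).1 ∧
        (τ _ (finSigmaFinEquiv.symm x).2).val < (τ _ (finSigmaFinEquiv.symm y).2).val) := by
  have key : ∀ z : Σ i, Fin (k i), (Equiv.sigmaCongrLeft' (β := fun i => Fin (k i)) σ z).1 = σ z.1
      ∧ (Equiv.sigmaCongrLeft' (β := fun i => Fin (k i)) σ z).2.val = z.2.val := by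
    intro z
    obtain ⟨w, rfl⟩ := (Equiv.sigmaCongrLeft' (β := fun i => Fin (k i)) σ).symm.surjective z
    rw [Equiv.apply_symm_apply]
    exact ⟨(σ.apply_symm_apply w.1).symm, rfl⟩
  have h1 : blockPerm σ τ x < blockPerm σ τ y ↔
      finSigmaFinEquiv (Equiv.sigmaCongrLeft' (β := fun i => Fin (k i)) σ
        (Equiv.sigmaCongrRight τ (finSigmaFinEquiv.symm x))) <
      finSigmaFinEquiv (Equiv.sigmaCongrLeft' (β := fun i => Fin (k i)) σ
        (Equiv.sigmaCongrRight τ (finSigmaFinEquiv.symm y))) := Iff.rfl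
  rw [h1, finSigma_lt]
  simp only [(key _).1, (key _).2, EmbeddingLike.apply_eq_iff_eq]
  rfl

/-- Equivalent operations only differ in the order of orthogonal pairs. -/
lemma Sim.rel_of_inversion {perp : OrthRel C} {n : ℕ} {c : Fin n → C} {t : C}
    {o o' : PreOp c t} (h : Sim perp o o') (i j : Fin n) (h₁ : o.perm i < o.perm j)
    (h₂ : o'.perm j < o'.perm i) : perp.rel (o.hom i) (o.hom j) := by
  induction h with
  | refl => exact absurd h₁ (not_lt.mpr h₂.le)
  | @tail q q' hq h ih =>
    rcases lt_trichotomy (q.perm i) (q.perm j) with h3 | h3 | h3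
    · have := h.rel_of_inversion i j h3 h₂
      rwa [← Sim.hom_eq hq] at this
    · rw [q.perm.injective h3] at h₁
      exact absurd h₁ (lt_irrefl _)
    · exact ih h3

lemma permute_sim {perp : OrthRel C} {n : ℕ} {c : Fin n → C} {t : C} (σ' : Equiv.Perm (Fin n))
    {o o' : PreOp c t} (h : Sim perp o o') : Sim perp (o.permute σ') (o'.permute σ') := by
  refine sim_of_inversions ?_ fun i j h1 h2 => h.rel_of_inversion _ _ h1 h2
  simp only [permute]
  rw [h.hom_eq]

lemma comp_sim {perp : OrthRel C} {m : ℕ} {a : Fin m → C} {t : C} {o o' : PreOp a t}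
    {k : Fin m → ℕ} {b : ∀ i, Fin (k i) → C} {p p' : ∀ i, PreOp (b i) (a i)}
    (ho : Sim perp o o') (hp : ∀ i, Sim perp (p i) (p' i)) :
    Sim perp (o.comp p) (o'.comp p') := by
  have key : ∀ u w : Σ i, Fin (k i),
      (o.perm u.1 < o.perm w.1 ∨
        (u.1 = w.1 ∧ ((p u.1).perm u.2).val < ((p w.1).perm w.2).val)) →
      (o'.perm w.1 < o'.perm u.1 ∨
        (w.1 = u.1 ∧ ((p' w.1).perm w.2).val < ((p' u.1).perm u.2).val)) →
      perp.rel ((p u.1).hom u.2 ≫ o.hom u.1) ((p w.1).hom w.2 ≫ o.hom w.1) := by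
    rintro ⟨i, u⟩ ⟨i', w⟩ h1 h2
    dsimp only at h1 h2 ⊢
    rcases h1 with h1 | ⟨rfl, h1⟩
    · rcases h2 with h2 | ⟨rfl, h2⟩
      · exact perp.precomp _ _ (ho.rel_of_inversion _ _ h1 h2)
      · exact absurd h1 (lt_irrefl _)
    · rcases h2 with h2 | ⟨-, h2⟩
      · exact absurd h2 (lt_irrefl _)
      · exact perp.postcomp _ ((hp i).rel_of_inversion _ _ h1 h2)
  refine sim_of_inversions ?_ fun x y h1 h2 => ?_
  · funext x
    simp only [comp]
    rw [ho.hom_eq, (hp _).hom_eq]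
  · exact key _ _ ((blockPerm_lt _ _ _ _).mp h1) ((blockPerm_lt _ _ _ _).mp h2)

/-- The equivalence relation `∼` as a setoid. -/
def setoid (perp : OrthRel C) {n : ℕ} (c : Fin n → C) (t : C) : Setoid (PreOp c t) where
  r := Sim perp
  iseqv := sim_equivalence perp c t

/-- The map `(σ, f) ↦ (σ, F(f))` induced by a functor `F`. -/
def map {D : Type v} [SmallCategory D] (F : C ⥤ D) {n : ℕ} {c : Fin n → C} {t : C}
    (o : PreOp c t) : PreOp (fun i => F.obj (c i)) (F.obj t) where
  perm := o.perm
  hom i := F.map (o.hom i)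

lemma map_sim {D : Type v} [SmallCategory D] {perpC : OrthRel C} {perpD : OrthRel D} {F : C ⥤ D}
    (hF : IsOrthFunctor perpC perpD F) {n : ℕ} {c : Fin n → C} {t : C} {o o' : PreOp c t}
    (h : Sim perpC o o') : Sim perpD (o.map F) (o'.map F) := by
  refine sim_of_inversions ?_ fun i j h1 h2 => hF _ _ (h.rel_of_inversion _ _ h1 h2)
  simp only [map]
  rw [h.hom_eq]

end PreOp

/-- The set `O_{(C,⊥)}(t; c) = O_C(t; c) / ∼` of operations of the coloured operad of the
orthogonal category `(C, ⊥)`. -/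
def Op (perp : OrthRel C) {n : ℕ} (c : Fin n → C) (t : C) : Type v :=
  Quotient (PreOp.setoid perp c t)

namespace Op

variable {perp : OrthRel C}

/-- The class `[σ, f]`. -/
def mk (perp : OrthRel C) {n : ℕ} {c : Fin n → C} {t : C} (o : PreOp c t) : Op perp c t :=
  Quotient.mk (PreOp.setoid perp c t) o

lemma mk_eq_mk {n : ℕ} {c : Fin n → C} {t : C} {o o' : PreOp c t} :
    mk perp o = mk perp o' ↔ PreOp.Sim perp o o' :=
  Quotient.eq (r := PreOp.setoid perp c t)

lemma exists_rep {n : ℕ} {c : Fin n → C} {t : C} (q : Op perp c t) :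
    ∃ o : PreOp c t, mk perp o = q :=
  Quotient.exists_rep q

/-- The permutation action on classes. -/
def permute {n : ℕ} {c : Fin n → C} {t : C} (σ' : Equiv.Perm (Fin n)) :
    Op perp c t → Op perp (c ∘ σ') t :=
  Quotient.lift (fun o => mk perp (o.permute σ')) fun _ _ h => mk_eq_mk.mpr (PreOp.permute_sim σ' h)

/-- The operadic unit. -/
def one (perp : OrthRel C) (t : C) : Op perp (fun _ : Fin 1 => t) t :=
  mk perp (PreOp.one t)

/-- The operadic composition on classes (it does not depend on the chosen representatives, see
`comp_mk`). -/
noncomputable def comp {m : ℕ} {a : Fin m → C} {t : C} (q : Op perp a t) {k : Fin m → ℕ}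
    {b : ∀ i, Fin (k i) → C} (p : ∀ i, Op perp (b i) (a i)) : Op perp (concat b) t :=
  mk perp ((exists_rep q).choose.comp fun i => (exists_rep (p i)).choose)

@[simp]
lemma permute_mk {n : ℕ} {c : Fin n → C} {t : C} (σ' : Equiv.Perm (Fin n)) (o : PreOp c t) :
    permute σ' (mk perp o) = mk perp (o.permute σ') := rfl

@[simp]
lemma comp_mk {m : ℕ} {a : Fin m → C} {t : C} (o : PreOp a t) {k : Fin m → ℕ}
    {b : ∀ i, Fin (k i) → C} (p : ∀ i, PreOp (b i) (a i)) :
    comp (mk perp o) (fun i => mk perp (p i)) = mk perp (o.comp p) :=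
  mk_eq_mk.mpr (PreOp.comp_sim
    (mk_eq_mk.mp (exists_rep (mk perp o)).choose_spec)
    fun i => mk_eq_mk.mp (exists_rep (mk perp (p i))).choose_spec)

variable {D : Type v} [SmallCategory D] {perpC : OrthRel C} {perpD : OrthRel D} {F : C ⥤ D}

/-- The components `[σ, f] ↦ [σ, F(f)]` of the operad morphism `O_F` induced by an orthogonal
functor `F`. -/
def map (hF : IsOrthFunctor perpC perpD F) {n : ℕ} {c : Fin n → C} {t : C} :
    Op perpC c t → Op perpD (fun i => F.obj (c i)) (F.obj t) :=
  Quotient.lift (fun o => mk perpD (o.map F)) fun _ _ h => mk_eq_mk.mpr (PreOp.map_sim hF h)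

lemma map_permute (hF : IsOrthFunctor perpC perpD F) {n : ℕ} {c : Fin n → C} {t : C}
    (σ' : Equiv.Perm (Fin n)) (q : Op perpC c t) :
    map hF (permute σ' q) = permute σ' (map hF q) := by
  obtain ⟨o, rfl⟩ := exists_rep q
  rfl

lemma map_one (hF : IsOrthFunctor perpC perpD F) (t : C) :
    map hF (one perpC t) = one perpD (F.obj t) := by
  refine congrArg (mk perpD) ?_
  simp only [PreOp.map, PreOp.one, F.map_id]

lemma map_comp (hF : IsOrthFunctor perpC perpD F) {m : ℕ} {a : Fin m → C} {t : C}
    (q : Op perpC a t) {k : Fin m → ℕ} {b : ∀ i, Fin (k i) → C}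
    (p : ∀ i, Op perpC (b i) (a i)) :
    map hF (comp q p) = comp (b := fun i j => F.obj (b i j)) (map hF q) fun i => map hF (p i) := by
  obtain ⟨o, rfl⟩ := exists_rep q
  choose p' hp' using fun i => exists_rep (p i)
  obtain rfl : (fun i => mk perpC (p' i)) = p := funext hp'
  rw [comp_mk]
  refine Eq.trans ?_ (comp_mk (perp := perpD) (b := fun i j => F.obj (b i j)) (o.map F)
    fun i => (p' i).map F).symm
  refine congrArg (mk perpD) ?_
  exact congrArg (PreOp.mk _) (funext fun _ => F.map_comp _ _)

end Op
end Operad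

/-! ### Finite tensor products in a symmetric monoidal category -/

section Tensor

variable {M : Type u} [Category.{v} M] [MonoidalCategory M]

/-- `X i₁ ⊗ (X i₂ ⊗ (⋯ ⊗ 𝟙))` for a list `[i₁, i₂, …]` of indices. -/
def tens {ι : Type} (X : ι → M) : List ι → M
  | [] => 𝟙_ M
  | i :: l => X i ⊗ tens X l

/-- The tensor product of a family of morphisms. -/
def tensMap {ι : Type} {X Y : ι → M} (f : ∀ i, X i ⟶ Y i) : ∀ l : List ι, tens X l ⟶ tens Y l
  | [] => 𝟙 (𝟙_ M)
  | i :: l => f i ⊗ₘ tensMap f l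

/-- Rebracketing: the tensor product over a concatenation of lists. -/
def tensAppend {ι : Type} (X : ι → M) : ∀ l l' : List ι, tens X (l ++ l') ≅ tens X l ⊗ tens X l'
  | [], l' => (λ_ (tens X l')).symm
  | i :: l, l' => whiskerLeftIso (X i) (tensAppend X l l') ≪≫ (α_ (X i) (tens X l) (tens X l')).symm

/-- The identification of the tensor products of `X i₁, X i₂, …` indexed in two ways. -/
def tensReindex {ι κ : Type} (g : κ → ι) (X : ι → M) :
    ∀ l : List κ, tens X (l.map g) ≅ tens (fun j => X (g j)) l
  | [] => Iso.refl (𝟙_ M)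
  | j :: l => whiskerLeftIso (X (g j)) (tensReindex g X l)

/-- `X₁ ⊗ ⋯ ⊗ Xₙ`. -/
def tensFin {n : ℕ} (X : Fin n → M) : M := tens X (List.finRange n)

/-- `f₁ ⊗ ⋯ ⊗ fₙ`. -/
def tensFinMap {n : ℕ} {X Y : Fin n → M} (f : ∀ i, X i ⟶ Y i) : tensFin X ⟶ tensFin Y :=
  tensMap f (List.finRange n)

lemma tensFinMap_id {n : ℕ} (X : Fin n → M) :
    tensFinMap (fun i => 𝟙 (X i)) = 𝟙 (tensFin X) := by
  have h : ∀ l : List (Fin n), tensMap (fun i => 𝟙 (X i)) l = 𝟙 (tens X l) := by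
    intro l
    induction l with
    | nil => rfl
    | cons i l ih =>
      rw [tensMap, ih]
      exact id_tensorHom_id (X i) (tens X l)
  exact h _

lemma tensFinMap_comp {n : ℕ} {X Y Z : Fin n → M} (f : ∀ i, X i ⟶ Y i) (g : ∀ i, Y i ⟶ Z i) :
    tensFinMap (fun i => f i ≫ g i) = tensFinMap f ≫ tensFinMap g := by
  have h : ∀ l : List (Fin n), tensMap (fun i => f i ≫ g i) l = tensMap f l ≫ tensMap g l := by
    intro l
    induction l with
    | nil => exact (Category.comp_id (𝟙 (𝟙_ M))).symm
    | cons i l ih =>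
      rw [tensMap, ih]
      exact (tensorHom_comp_tensorHom (f i) (tensMap f l) (g i) (tensMap g l)).symm
  exact h _

/-- The lexicographic list of the pairs `(i, j)` with `i` in a given list. -/
def lexList {m : ℕ} (k : Fin m → ℕ) : List (Fin m) → List (Σ i, Fin (k i))
  | [] => []
  | i :: l => (List.finRange (k i)).map (Sigma.mk i) ++ lexList k l

lemma mem_lexList {m : ℕ} (k : Fin m → ℕ) (x : Σ i, Fin (k i)) (l : List (Fin m)) :
    x ∈ lexList k l ↔ x.1 ∈ l := by
  induction l with
  | nil => simp [lexList]
  | cons i l ih =>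
    obtain ⟨i', j⟩ := x
    simp only [lexList, List.mem_append, ih, List.mem_map, List.mem_finRange, true_and,
      List.mem_cons]
    refine or_congr ⟨?_, ?_⟩ Iff.rfl
    · rintro ⟨j', h⟩
      exact (congrArg Sigma.fst h).symm
    · rintro rfl
      exact ⟨j, rfl⟩

lemma map_finRange_eq_lexList {m : ℕ} (k : Fin m → ℕ) :
    (List.finRange (∑ i, k i)).map finSigmaFinEquiv.symm = lexList k (List.finRange m) := by
  have hp : ∀ l : List (Fin m), l.Pairwise (· < ·) →
      ((lexList k l).map finSigmaFinEquiv).Pairwise (· < ·) := by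
    intro l hl
    induction l with
    | nil => simp [lexList]
    | cons i l ih =>
      rw [List.pairwise_cons] at hl
      rw [lexList, List.map_append, List.pairwise_append]
      refine ⟨?_, ih hl.2, ?_⟩
      · rw [List.map_map, List.pairwise_map]
        refine (List.sortedLT_finRange (k i)).pairwise.imp ?_
        intro a b hab
        exact (PreOp.finSigma_lt _ _).mpr (Or.inr ⟨rfl, hab⟩)
      · intro x hx y hy
        simp only [List.mem_map, List.mem_finRange, true_and] at hx hy
        obtain ⟨_, ⟨a, rfl⟩, rfl⟩ := hx
        obtain ⟨w, hw, rfl⟩ := hy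
        rw [mem_lexList] at hw
        exact (PreOp.finSigma_lt _ _).mpr (Or.inl (hl.1 _ hw))
  have h : List.finRange (∑ i, k i) = (lexList k (List.finRange m)).map finSigmaFinEquiv := by
    refine (List.sortedLT_finRange _).eq_of_mem_iff
      (hp _ (List.sortedLT_finRange m).pairwise).sortedLT ?_
    intro x
    simp only [List.mem_finRange, List.mem_map, mem_lexList, true_and, true_iff]
    exact ⟨finSigmaFinEquiv.symm x, finSigmaFinEquiv.apply_symm_apply x⟩
  rw [h, List.map_map]
  simp

/-- Rebracketing of a tensor product of blocks. -/
def tensLex {m : ℕ} {k : Fin m → ℕ} (Y : (Σ i, Fin (k i)) → M) :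
    ∀ l : List (Fin m), tens Y (lexList k l) ≅ tens (fun i => tensFin fun j => Y ⟨i, j⟩) l
  | [] => Iso.refl (𝟙_ M)
  | i :: l => tensAppend Y _ _ ≪≫
      (tensReindex (Sigma.mk i) Y (List.finRange (k i)) ⊗ᵢ tensLex Y l)

/-- The canonical isomorphism from the tensor product of the `Y i j`, taken in lexicographic
order, to the iterated tensor product `⨂ᵢ ⨂ⱼ Y i j`. -/
def tensConcat {m : ℕ} {k : Fin m → ℕ} (Y : (Σ i, Fin (k i)) → M) :
    tensFin (fun x : Fin (∑ i, k i) => Y (finSigmaFinEquiv.symm x)) ≅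
      tensFin fun i => tensFin fun j => Y ⟨i, j⟩ :=
  (tensReindex finSigmaFinEquiv.symm Y (List.finRange (∑ i, k i))).symm ≪≫
    eqToIso (congrArg (tens Y) (map_finRange_eq_lexList k)) ≪≫ tensLex Y (List.finRange m)

/-- Rearrangements of a list, written as composites of transpositions of adjacent entries. -/
inductive Rearr {ι : Type} : List ι → List ι → Type
  | nil : Rearr [] []
  | cons (i : ι) {l l' : List ι} : Rearr l l' → Rearr (i :: l) (i :: l')
  | swap (i j : ι) (l : List ι) : Rearr (i :: j :: l) (j :: i :: l)
  | trans {l l' l'' : List ι} : Rearr l l' → Rearr l' l'' → Rearr l l''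

/-- The permutation of tensor factors, by means of the symmetric braiding, along a
rearrangement. -/
def Rearr.braid [SymmetricCategory M] {ι : Type} (X : ι → M) :
    ∀ {l l' : List ι}, Rearr l l' → (tens X l ⟶ tens X l')
  | _, _, .nil => 𝟙 (𝟙_ M)
  | _, _, .cons i w => X i ◁ w.braid X
  | _, _, .swap i j l => (α_ (X i) (X j) (tens X l)).inv ≫ ((β_ (X i) (X j)).hom ▷ tens X l) ≫
      (α_ (X j) (X i) (tens X l)).hom
  | _, _, .trans w w' => w.braid X ≫ w'.braid X

lemma Rearr.nonempty_of_perm {ι : Type} {l l' : List ι} (h : l.Perm l') : Nonempty (Rearr l l') := by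
  induction h with
  | nil => exact ⟨.nil⟩
  | cons i _ ih => exact ih.map (.cons i)
  | swap i j l => exact ⟨.swap j i l⟩
  | trans _ _ ih ih' => exact ih.elim fun w => ih'.map fun w' => w.trans w'

/-- The permutation `τ_σ : X₁ ⊗ ⋯ ⊗ Xₙ ⟶ X_{σ(1)} ⊗ ⋯ ⊗ X_{σ(n)}` of tensor factors, for a
permutation `σ` that is written as a composite `w` of transpositions of adjacent entries. (Every
`σ` can be so written, and by coherence the result does not depend on `w`.) -/
def braidPerm [SymmetricCategory M] {n : ℕ} (X : Fin n → M) (σ : Equiv.Perm (Fin n))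
    (w : Rearr (List.finRange n) ((List.finRange n).map σ)) :
    tensFin X ⟶ tensFin fun i => X (σ i) :=
  w.braid X ≫ (tensReindex σ X (List.finRange n)).hom

end Tensor

/-! ### Algebras over the operad of an orthogonal category -/

section Algebra

variable (M : Type u) [Category.{v} M] [MonoidalCategory M] [SymmetricCategory M]
variable {C : Type v} [SmallCategory C]

/-- An algebra in `M` over the coloured operad `O_{(C,⊥)}`: a family of objects `A_t`, together with
structure maps `O(t; c) ⊗ A_{c₁} ⊗ ⋯ ⊗ A_{cₙ} ⟶ A_t` that satisfy the equivariance, unitality and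
associativity axioms. Here the set `O(t; c)` is regarded as the object `∐_{O(t; c)} I` of `M`; as
`⊗` preserves coproducts in each variable for closed `M`, the structure map is the same as a family
of morphisms `A_{c₁} ⊗ ⋯ ⊗ A_{cₙ} ⟶ A_t`, one for each operation `q ∈ O(t; c)`. -/
structure Alg (perp : OrthRel C) where
  obj : C → M
  act : ∀ {n : ℕ} {c : Fin n → C} {t : C}, Op perp c t → (tensFin (fun i => obj (c i)) ⟶ obj t)
  act_permute : ∀ {n : ℕ} {c : Fin n → C} {t : C} (q : Op perp c t) (σ : Equiv.Perm (Fin n))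
    (w : Rearr (List.finRange n) ((List.finRange n).map σ)),
    braidPerm (fun i => obj (c i)) σ w ≫ act (q.permute σ) = act q
  act_one : ∀ t : C, act (Op.one perp t) = (ρ_ (obj t)).hom
  act_comp : ∀ {m : ℕ} {a : Fin m → C} {t : C} (q : Op perp a t) {k : Fin m → ℕ}
    {b : ∀ i, Fin (k i) → C} (p : ∀ i, Op perp (b i) (a i)),
    act (q.comp p) =
      (tensConcat fun x : Σ i, Fin (k i) => obj (b x.1 x.2)).hom ≫
        tensFinMap (fun i => act (p i)) ≫ act q

variable {M}

namespace Alg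

variable {perp : OrthRel C}

/-- Morphisms of algebras: families of morphisms compatible with the structure maps. -/
@[ext]
structure Hom (A B : Alg M perp) where
  app : ∀ t : C, A.obj t ⟶ B.obj t
  comm : ∀ {n : ℕ} {c : Fin n → C} {t : C} (q : Op perp c t),
    A.act q ≫ app t = tensFinMap (fun i => app (c i)) ≫ B.act q

instance : Category.{v} (Alg M perp) where
  Hom A B := Hom A B
  id A :=
    { app := fun t => 𝟙 (A.obj t)
      comm := fun q => by
        rw [tensFinMap_id, Category.comp_id, Category.id_comp] }
  comp f g :=
    { app := fun t => f.app t ≫ g.app t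
      comm := fun q => by
        rw [← Category.assoc, f.comm, Category.assoc, g.comm, ← Category.assoc, tensFinMap_comp] }
  id_comp f := Hom.ext (funext fun t => Category.id_comp (f.app t))
  comp_id f := Hom.ext (funext fun t => Category.comp_id (f.app t))
  assoc f g h := Hom.ext (funext fun t => Category.assoc (f.app t) (g.app t) (h.app t))

@[simp]
lemma id_app (A : Alg M perp) (t : C) : Hom.app (𝟙 A) t = 𝟙 (A.obj t) := rfl

@[simp]
lemma comp_app {A B E : Alg M perp} (f : A ⟶ B) (g : B ⟶ E) (t : C) :
    Hom.app (f ≫ g) t = f.app t ≫ g.app t := rfl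

variable {D : Type v} [SmallCategory D] {perpC : OrthRel C} {perpD : OrthRel D} {F : C ⥤ D}

/-- The pullback of an algebra along the operad morphism `O_F`: the underlying family of objects
is `B_{F(t)}`, and an operation `q` acts as `O_F(q)` does on `B`. -/
def pullbackObj (hF : IsOrthFunctor perpC perpD F) (B : Alg M perpD) : Alg M perpC where
  obj t := B.obj (F.obj t)
  act q := B.act (Op.map hF q)
  act_permute q σ w := by
    rw [Op.map_permute]
    exact B.act_permute (Op.map hF q) σ w
  act_one t := by
    rw [Op.map_one]
    exact B.act_one (F.obj t)
  act_comp q k b p := by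
    rw [Op.map_comp]
    exact B.act_comp (b := fun i j => F.obj (b i j)) (Op.map hF q) fun i => Op.map hF (p i)

/-- The pullback functor `O_F^* : Alg(O_{(D,⊥)}) ⥤ Alg(O_{(C,⊥)})`. -/
def pullback (hF : IsOrthFunctor perpC perpD F) : Alg M perpD ⥤ Alg M perpC where
  obj B := pullbackObj hF B
  map f :=
    { app := fun t => f.app (F.obj t)
      comm := fun q => f.comm (Op.map hF q) }

end Alg
end Algebra

/-! ### Full orthogonal subcategories and local objects -/

section Local

variable {M : Type u} [Category.{v} M] [MonoidalCategory M] [SymmetricCategory M]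
variable {C D : Type v} [SmallCategory C] [SmallCategory D]

/-- The restriction functor `O_j^*` for a functor `j : C ⥤ D`, where `C` carries the pulled back
orthogonality relation `j^*(⊥)`. -/
abbrev restriction (M : Type u) [Category.{v} M] [MonoidalCategory M] [SymmetricCategory M]
    (perp : OrthRel D) (j : C ⥤ D) : Alg M perp ⥤ Alg M (perp.pullback j) :=
  Alg.pullback (isOrthFunctor_pullback perp j)

variable {perp : OrthRel D} {j : C ⥤ D} {L : Alg M (perp.pullback j) ⥤ Alg M perp}

/-- `A` is `j`-local: the component at `A` of the counit of `O_j! ⊣ O_j^*` is an isomorphism. -/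
def jLocal (adj : L ⊣ restriction M perp j) : ObjectProperty (Alg M perp) :=
  fun A => IsIso (adj.counit.app A)

/-- If `O_j!` takes values in `j`-local algebras, the adjunction `O_j! ⊣ O_j^*` restricts to the full
subcategory of `j`-local algebras. -/
def restrictedAdjunction (adj : L ⊣ restriction M perp j) (h : ∀ B, jLocal adj (L.obj B)) :
    (jLocal adj).lift L h ⊣ (jLocal adj).ι ⋙ restriction M perp j :=
  Adjunction.mkOfUnitCounit
    { unit := { app := fun B => adj.unit.app B
                naturality := fun _ _ f => adj.unit.naturality f }
      counit := { app := fun A => ObjectProperty.homMk (adj.counit.app A.obj)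
                  naturality := fun _ _ f => by
                    ext1
                    exact adj.counit.naturality f.hom }
      left_triangle := by
        ext B : 2
        apply (jLocal adj).ι.map_injective
        simp
      right_triangle := by
        ext A : 2
        simp }

end Local
end OrthQFT

namespace OrthQFT

/-! ### Monoids presented by generating monoids and commutation relations -/

section PresentedMonoid

local notation "η" => MonObj.one
local notation "μ" => MonObj.mul

variable {M : Type u} [Category.{v} M] [MonoidalCategory M]

/-! An operation `[σ, f]` pushes its inputs forward along the morphisms `fᵢ` and multiplies the
results in the order given by `σ⁻¹`. An algebra is therefore the same thing as a functor `F : C ⥤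
Mon M` under which orthogonal pairs have commuting images (`PerpCommuting`). `Alg.diagram` and
`algOfDiagram` pass between the two descriptions; `Alg.act_mk_eq_eval` and `diagramOfAlg` say that
nothing is lost. Morphisms of algebras are natural transformations, and restriction along `j`
becomes precomposition with `j` (`diagramRestriction`).

For diagrams the left adjoint is explicit. Its value `extObj` at `t` is the monoid generated by one
copy of `G c` for each `f : j c ⟶ t`, with copies identified along morphisms over `t` and with
copies at orthogonal `f`, `f'` made to commute. This monoid is a colimit of tensor words over
elementary relations; since `M` is closed, tensoring preserves the colimit, so concatenation of
words descends to a multiplication. Stability of `⊥` under precomposition turns commutation of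
generators into commutation of the images of orthogonal morphisms (`perpCommuting_ext`).

Let `j` be fully faithful. Over `t = j c` every generating arrow `k : j b ⟶ j c` is `j g` for a
unique `g`, so its copy of `G b` factors through the copy of `G c` at the identity. Sending the copy
at `k` to `G g` is well defined because `G` already satisfies the relations for `j^*(⊥)`, and it
inverts the unit (`isIso_extUnit`). The units of any two left adjoints agree up to isomorphism, both
being initial under `B` (`isIso_unit`). The rest is formal: a triangle identity makes the counit
invertible on the image of the left adjoint, and on local objects it is invertible by definition.

The technical weight lies in the dictionary. One direction needs coherence, i.e. independence of the
chosen word of transpositions (`Rearr.braid_eq`), and compatibility with block permutations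
(`PreOp.eval_comp`). The other extracts the monoid axioms from one composition law for operations
with trivial permutation (`Alg.actList_flatLists`). -/

lemma leftUnitor_inv_one_tensor_mul {N x : M} [MonObj N] (f : x ⟶ N) :
    (λ_ x).inv ≫ (η ⊗ₘ f) ≫ μ = f := by
  rw [MonObj.one_mul_hom, Iso.inv_hom_id_assoc]

lemma rightUnitor_inv_tensor_one_mul {N x : M} [MonObj N] (f : x ⟶ N) :
    (ρ_ x).inv ≫ (f ⊗ₘ η) ≫ μ = f := by
  rw [MonObj.mul_one_hom, Iso.inv_hom_id_assoc]

/-- Associativity for generalized elements; it is the rebracketing rule behind the computations with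
words and products below. -/
lemma hom_mul_assoc {N : M} [MonObj N] {x y z : M} (f : x ⟶ N) (g : y ⟶ N) (h : z ⟶ N) :
    (f ⊗ₘ ((g ⊗ₘ h) ≫ μ)) ≫ μ = (α_ x y z).inv ≫ (((f ⊗ₘ g) ≫ μ) ⊗ₘ h) ≫ μ := by
  rw [← Category.comp_id h, ← tensorHom_comp_tensorHom_assoc, Category.comp_id, tensorHom_id,
    MonObj.mul_assoc, ← associator_inv_naturality_assoc, Iso.inv_hom_id_assoc, ← id_tensorHom,
    tensorHom_comp_tensorHom_assoc, Category.comp_id]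

/-- Two morphisms into a monoid commute. -/
def Commuting [BraidedCategory M] {N : M} [MonObj N] {x y : M} (f : x ⟶ N) (g : y ⟶ N) : Prop :=
  (f ⊗ₘ g) ≫ μ = (β_ x y).hom ≫ (g ⊗ₘ f) ≫ μ

namespace Commuting

variable [BraidedCategory M] {N : M} [MonObj N] {x x' y z : M}

lemma precomp {f : x ⟶ N} {g : y ⟶ N} (h : Commuting f g) (a : x' ⟶ x) :
    Commuting (a ≫ f) g := by
  have := congrArg (fun t => a ▷ y ≫ t) h
  simp only [Commuting, ← tensorHom_id, tensorHom_comp_tensorHom_assoc, Category.id_comp] at this ⊢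
  rw [this, tensorHom_id, BraidedCategory.braiding_naturality_left_assoc, ← id_tensorHom,
    tensorHom_comp_tensorHom_assoc, Category.id_comp]

lemma one_left (g : y ⟶ N) : Commuting (η : 𝟙_ M ⟶ N) g := by
  simp [Commuting]

/-- By the hexagon, moving `g` past a product moves it past the factors one at a time. -/
lemma mul_left {f : x ⟶ N} {f' : x' ⟶ N} {g : y ⟶ N} (h : Commuting f g) (h' : Commuting f' g) :
    Commuting ((f ⊗ₘ f') ≫ μ) g := by
  unfold Commuting at *
  rw [BraidedCategory.braiding_tensor_left_hom]
  simp only [Category.assoc]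
  rw [hom_mul_assoc, Iso.hom_inv_id_assoc, ← tensorHom_id (β_ x y).hom, tensorHom_comp_tensorHom_assoc,
    Category.id_comp, ← h, ← hom_mul_assoc, ← id_tensorHom x, tensorHom_comp_tensorHom_assoc,
    Category.id_comp, ← h', hom_mul_assoc, Iso.hom_inv_id_assoc]

end Commuting

lemma Commuting.symm [SymmetricCategory M] {N : M} [MonObj N] {x y : M} {f : x ⟶ N} {g : y ⟶ N}
    (h : Commuting f g) : Commuting g f := by
  unfold Commuting at *
  rw [h, SymmetricCategory.symmetry_assoc]

/-! ### Words, elementary relations, and their colimit -/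

variable {K : Type v}

/-- The tensor product of the objects underlying a word of monoids. -/
@[reducible]
def tensWord (X : K → Mon M) : List K → M
  | [] => 𝟙_ M
  | k :: w => (X k).X ⊗ tensWord X w

variable [SmallCategory K]

/-- The relations between words of generating monoids: multiplication and units of the
generators, functoriality in the generators, and commutation of the pairs in `P`. -/
inductive MonRel (P : K → K → Prop) : List K → List K → Type v
  | mul (k : K) (w : List K) : MonRel P (k :: k :: w) (k :: w)
  | one (k : K) (w : List K) : MonRel P w (k :: w)
  | map {k k' : K} (g : k ⟶ k') (w : List K) : MonRel P (k :: w) (k' :: w)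
  | swap {k k' : K} (h : P k k') (w : List K) : MonRel P (k :: k' :: w) (k' :: k :: w)
  | cons (k : K) {w w' : List K} : MonRel P w w' → MonRel P (k :: w) (k :: w')

/-- The morphism of tensor products of words that a relation stands for. -/
def MonRel.interp [BraidedCategory M] {P : K → K → Prop} (X : K ⥤ Mon M) :
    ∀ {w w' : List K}, MonRel P w w' → (tensWord X.obj w ⟶ tensWord X.obj w')
  | _, _, .mul k w => (α_ (X.obj k).X (X.obj k).X (tensWord X.obj w)).inv ≫
      MonObj.mul (X := (X.obj k).X) ▷ tensWord X.obj w
  | _, _, .one k w => (λ_ (tensWord X.obj w)).inv ≫ MonObj.one (X := (X.obj k).X) ▷ tensWord X.obj w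
  | _, _, .map g w => (X.map g).hom ▷ tensWord X.obj w
  | _, _, .swap (k := k) (k' := k') _ w =>
      (α_ (X.obj k).X (X.obj k').X (tensWord X.obj w)).inv ≫
        (β_ (X.obj k).X (X.obj k').X).hom ▷ tensWord X.obj w ≫
          (α_ (X.obj k').X (X.obj k).X (tensWord X.obj w)).hom
  | _, _, .cons k r => (X.obj k).X ◁ r.interp X

variable [BraidedCategory M]

/-- The diagram of words and relations. -/
def presentation (P : K → K → Prop) (X : K ⥤ Mon M) :
    MultispanIndex (⟨Σ (w : List K) (w' : List K), MonRel P w w', List K, fun r => r.1,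
      fun r => r.2.1⟩ : MultispanShape.{v, v}) M where
  left r := tensWord X.obj r.1
  right w := tensWord X.obj w
  fst _ := 𝟙 _
  snd r := r.2.2.interp X

variable (P : K → K → Prop) (X : K ⥤ Mon M) [HasColimits M]

/-- The object underlying the presented monoid. -/
noncomputable def presObj : M := multicoequalizer (presentation P X)

variable {P}

/-- The value of a word in the presented monoid. -/
noncomputable def wordι (w : List K) : tensWord X.obj w ⟶ presObj P X :=
  Multicoequalizer.π (presentation P X) w

variable {X}

lemma interp_wordι {w w' : List K} (r : MonRel P w w') :
    r.interp X ≫ wordι X w' = wordι (P := P) X w := by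
  refine (Multicoequalizer.condition (presentation P X) ⟨w, w', r⟩).symm.trans ?_
  exact Category.id_comp _

lemma presObj_hom_ext {Z : M} {f g : presObj P X ⟶ Z}
    (h : ∀ w, wordι X w ≫ f = wordι X w ≫ g) : f = g :=
  Multicoequalizer.hom_ext _ _ _ h

/-- Descent of a compatible family of morphisms. -/
noncomputable def presDesc {Z : M} (f : ∀ w, tensWord X.obj w ⟶ Z)
    (hf : ∀ (w w' : List K) (r : MonRel P w w'), r.interp X ≫ f w' = f w) : presObj P X ⟶ Z :=
  Multicoequalizer.desc (presentation P X) Z f fun r => (Category.id_comp _).trans (hf _ _ r.2.2).symm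

@[simp]
lemma wordι_presDesc {Z : M} (f : ∀ w, tensWord X.obj w ⟶ Z)
    (hf : ∀ (w w' : List K) (r : MonRel P w w'), r.interp X ≫ f w' = f w) (w : List K) :
    wordι X w ≫ presDesc f hf = f w :=
  Multicoequalizer.π_desc (presentation P X) Z f _ w

variable [MonoidalClosed M]

open MonoidalClosed in
-- Tensoring with `Y` is a left adjoint, so after currying a morphism out of `Y ⊗ presObj P X` is
-- again tested on words.
lemma whiskerLeft_presObj_hom_ext {Y Z : M} {f g : Y ⊗ presObj P X ⟶ Z}
    (h : ∀ w, Y ◁ wordι X w ≫ f = Y ◁ wordι X w ≫ g) : f = g := by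
  apply curry_injective
  apply presObj_hom_ext
  intro w
  rw [← curry_natural_left, ← curry_natural_left, h]

open MonoidalClosed in
lemma whiskerLeft_presObj_whiskerRight_hom_ext {Y Z W : M} {f g : (Y ⊗ presObj P X) ⊗ Z ⟶ W}
    (h : ∀ w, (Y ◁ wordι X w) ▷ Z ≫ f = (Y ◁ wordι X w) ▷ Z ≫ g) : f = g := by
  rw [← cancel_epi (β_ _ _).hom]
  apply curry_injective
  apply whiskerLeft_presObj_hom_ext
  intro w
  rw [← curry_natural_left, ← curry_natural_left]
  simp only [BraidedCategory.braiding_naturality_right_assoc, h]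

lemma presObj_whiskerRight_hom_ext {Y Z : M} {f g : presObj P X ⊗ Y ⟶ Z}
    (h : ∀ w, wordι X w ▷ Y ≫ f = wordι X w ▷ Y ≫ g) : f = g := by
  rw [← cancel_epi (β_ _ _).hom]
  apply whiskerLeft_presObj_hom_ext
  intro w
  simp only [BraidedCategory.braiding_naturality_right_assoc, h]

open MonoidalClosed in
/-- Descent of a compatible family of morphisms with a parameter on the left. -/
noncomputable def presDescLeft {Y Z : M} (f : ∀ w, Y ⊗ tensWord X.obj w ⟶ Z)
    (hf : ∀ (w w' : List K) (r : MonRel P w w'), Y ◁ r.interp X ≫ f w' = f w) :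
    Y ⊗ presObj P X ⟶ Z :=
  uncurry (presDesc (fun w => curry (f w)) fun _ _ r => by rw [← curry_natural_left, hf])

open MonoidalClosed in
@[simp]
lemma wordι_presDescLeft {Y Z : M} (f : ∀ w, Y ⊗ tensWord X.obj w ⟶ Z)
    (hf : ∀ (w w' : List K) (r : MonRel P w w'), Y ◁ r.interp X ≫ f w' = f w) (w : List K) :
    Y ◁ wordι X w ≫ presDescLeft f hf = f w := by
  rw [presDescLeft, ← uncurry_natural_left, wordι_presDesc, uncurry_curry]

/-- Descent of a compatible family of morphisms with a parameter on the right. -/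
noncomputable def presDescRight {Y Z : M} (f : ∀ w, tensWord X.obj w ⊗ Y ⟶ Z)
    (hf : ∀ (w w' : List K) (r : MonRel P w w'), r.interp X ▷ Y ≫ f w' = f w) :
    presObj P X ⊗ Y ⟶ Z :=
  (β_ _ _).hom ≫ presDescLeft (fun w => (β_ _ _).inv ≫ f w) fun _ _ r => by
    rw [BraidedCategory.braiding_inv_naturality_right_assoc, hf]

@[simp]
lemma wordι_presDescRight {Y Z : M} (f : ∀ w, tensWord X.obj w ⊗ Y ⟶ Z)
    (hf : ∀ (w w' : List K) (r : MonRel P w w'), r.interp X ▷ Y ≫ f w' = f w) (w : List K) :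
    wordι X w ▷ Y ≫ presDescRight f hf = f w := by
  rw [presDescRight, BraidedCategory.braiding_naturality_left_assoc, wordι_presDescLeft,
    Iso.hom_inv_id_assoc]

/-- Left multiplication by a generator. -/
noncomputable def letterMul (k : K) : (X.obj k).X ⊗ presObj P X ⟶ presObj P X :=
  -- The constructor `cons` of `MonRel` closes the relations under a left context, which is exactly
  -- what descent needs here.
  presDescLeft (fun w => wordι X (k :: w)) fun _ _ r => interp_wordι (.cons k r)

@[simp]
lemma wordι_letterMul (k : K) (w : List K) :
    (X.obj k).X ◁ wordι X w ≫ letterMul (P := P) k = wordι X (k :: w) :=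
  wordι_presDescLeft _ _ w

/-- Left multiplication by a word. -/
noncomputable def wordMul : ∀ w : List K, tensWord X.obj w ⊗ presObj P X ⟶ presObj P X
  | [] => (λ_ _).hom
  | k :: w => (α_ (X.obj k).X (tensWord X.obj w) _).hom ≫ (X.obj k).X ◁ wordMul w ≫ letterMul k

/-- Each generating monoid acts on the presented object from the left. This lemma and the next three
say that the actions respect the four kinds of relation; on words each one is the relation itself.
-/
lemma letterMul_mul (k : K) :
    μ ▷ _ ≫ letterMul (P := P) k =
      (α_ (X.obj k).X (X.obj k).X (presObj P X)).hom ≫ (X.obj k).X ◁ letterMul k ≫ letterMul k := by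
  apply whiskerLeft_presObj_hom_ext
  intro w
  rw [whisker_exchange_assoc, associator_naturality_right_assoc, ← whiskerLeft_comp_assoc,
    wordι_letterMul, wordι_letterMul, ← interp_wordι (.mul k w), MonRel.interp,
    Category.assoc, Iso.hom_inv_id_assoc]

lemma letterMul_one (k : K) :
    η ▷ _ ≫ letterMul (P := P) k = (λ_ (presObj P X)).hom := by
  rw [← cancel_epi (λ_ (presObj P X)).inv, Iso.inv_hom_id]
  apply presObj_hom_ext
  intro w
  rw [leftUnitor_inv_naturality_assoc, whisker_exchange_assoc, wordι_letterMul,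
    Category.comp_id, ← interp_wordι (.one k w), MonRel.interp, Category.assoc]

lemma letterMul_map {k k' : K} (g : k ⟶ k') :
    (X.map g).hom ▷ _ ≫ letterMul (P := P) k' = letterMul k := by
  apply whiskerLeft_presObj_hom_ext
  intro w
  rw [whisker_exchange_assoc, wordι_letterMul, wordι_letterMul, ← interp_wordι (.map g w),
    MonRel.interp]

lemma letterMul_swap {k k' : K} (h : P k k') :
    (α_ (X.obj k).X (X.obj k').X (presObj P X)).hom ≫
      (X.obj k).X ◁ letterMul k' ≫ letterMul (P := P) k =
      (β_ _ _).hom ▷ _ ≫ (α_ _ _ _).hom ≫ (X.obj k').X ◁ letterMul k ≫ letterMul k' := by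
  apply whiskerLeft_presObj_hom_ext
  intro w
  rw [whisker_exchange_assoc, associator_naturality_right_assoc, associator_naturality_right_assoc,
    ← whiskerLeft_comp_assoc, ← whiskerLeft_comp_assoc, wordι_letterMul, wordι_letterMul,
    wordι_letterMul, wordι_letterMul, ← interp_wordι (.swap h w), MonRel.interp,
    Category.assoc, Category.assoc, Iso.hom_inv_id_assoc]

/-- Isolates the two leading letters, so that a relation exchanging them can be applied before the
rest of the word acts. -/
lemma associator_whiskerRight_wordMul (k k' : K) (w : List K) :
    (α_ (X.obj k).X (X.obj k').X (tensWord X.obj w)).hom ▷ presObj P X ≫ (α_ _ _ _).hom ≫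
      (X.obj k).X ◁ ((α_ _ _ _).hom ≫ (X.obj k').X ◁ wordMul w ≫ letterMul k') ≫ letterMul k =
    (α_ _ _ _).hom ≫ _ ◁ wordMul w ≫ (α_ _ _ _).hom ≫ (X.obj k).X ◁ letterMul k' ≫ letterMul k := by
  simp

/-- Related words act equally: a relation at the head of a word is a relation between the letter
actions, and `cons` is the induction step. -/
lemma interp_wordMul {w w' : List K} (r : MonRel P w w') :
    r.interp X ▷ presObj P X ≫ wordMul w' = wordMul w := by
  induction r with
  | mul k w =>
    simp only [MonRel.interp, wordMul]
    rw [comp_whiskerRight_assoc, associator_naturality_left_assoc, ← whisker_exchange_assoc,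
      letterMul_mul]
    simp
  | one k w =>
    simp only [MonRel.interp, wordMul]
    rw [comp_whiskerRight_assoc, associator_naturality_left_assoc, ← whisker_exchange_assoc,
      letterMul_one]
    simp
  | map g w =>
    simp only [MonRel.interp, wordMul]
    rw [associator_naturality_left_assoc, ← whisker_exchange_assoc, letterMul_map]
  | swap h w =>
    simp only [MonRel.interp, wordMul]
    simp only [comp_whiskerRight, Category.assoc]
    rw [associator_whiskerRight_wordMul, associator_naturality_left_assoc,
      ← whisker_exchange_assoc, ← letterMul_swap h, ← associator_whiskerRight_wordMul]
    simp
  | cons k r ih =>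
    simp only [MonRel.interp, wordMul, ← ih]
    rw [associator_naturality_middle_assoc, whiskerLeft_comp_assoc]

/-- The multiplication of the presented monoid. -/
noncomputable def presMul : presObj P X ⊗ presObj P X ⟶ presObj P X :=
  presDescRight wordMul fun _ _ => interp_wordMul

@[simp]
lemma wordι_presMul (w : List K) :
    wordι X w ▷ presObj P X ≫ presMul = wordMul (P := P) (X := X) w :=
  wordι_presDescRight _ _ w

/-- Left action by a letter commutes with right multiplication. Induction on words extends this to
`wordMul_presMul`, which is associativity tested on words. -/
lemma letterMul_presMul (k : K) :
    letterMul k ▷ presObj P X ≫ presMul =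
      (α_ (X.obj k).X (presObj P X) (presObj P X)).hom ≫ (X.obj k).X ◁ presMul ≫ letterMul k := by
  apply whiskerLeft_presObj_whiskerRight_hom_ext
  intro w
  rw [← comp_whiskerRight_assoc, wordι_letterMul, wordι_presMul, associator_naturality_middle_assoc,
    ← whiskerLeft_comp_assoc, wordι_presMul, wordMul]

lemma wordMul_presMul (w : List K) :
    wordMul w ▷ presObj P X ≫ presMul =
      (α_ (tensWord X.obj w) (presObj P X) (presObj P X)).hom ≫ tensWord X.obj w ◁ presMul ≫
        wordMul w := by
  induction w with
  | nil => simp [wordMul]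
  | cons k w ih =>
    rw [wordMul, comp_whiskerRight_assoc, comp_whiskerRight_assoc, letterMul_presMul,
      associator_naturality_middle_assoc, ← whiskerLeft_comp_assoc, ih,
      associator_naturality_right_assoc]
    simp

lemma whiskerLeft_nil_wordMul (w : List K) :
    tensWord X.obj w ◁ wordι X [] ≫ wordMul w = (ρ_ (tensWord X.obj w)).hom ≫ wordι (P := P) X w := by
  induction w with
  | nil =>
    rw [wordMul, leftUnitor_naturality, unitors_equal]
  | cons k w ih =>
    rw [wordMul, associator_naturality_right_assoc, ← whiskerLeft_comp_assoc, ih,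
      whiskerLeft_comp_assoc, wordι_letterMul]
    simp

noncomputable instance presMonObj : MonObj (presObj P X) where
  one := wordι X []
  mul := presMul
  -- The empty word acts by the left unitor, by definition of `wordMul`.
  one_mul := wordι_presMul []
  mul_one := by
    apply presObj_whiskerRight_hom_ext
    intro w
    rw [← whisker_exchange_assoc, wordι_presMul, whiskerLeft_nil_wordMul, rightUnitor_naturality]
  mul_assoc := by
    rw [← Iso.inv_comp_eq]
    apply presObj_whiskerRight_hom_ext
    intro w
    rw [← whisker_exchange_assoc, wordι_presMul, associator_inv_naturality_left_assoc,
      ← comp_whiskerRight_assoc, wordι_presMul, wordMul_presMul, Iso.inv_hom_id_assoc]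

variable (P X) in
/-- The monoid presented by the monoids `X.obj k`, the morphisms `X.map g` and the commutation of the
pairs in `P`. -/
noncomputable abbrev presMon : Mon M := ⟨presObj P X⟩

/-- The inclusion of a generating monoid, as a morphism of objects. -/
noncomputable def letterι (k : K) : (X.obj k).X ⟶ presObj P X :=
  (ρ_ (X.obj k).X).inv ≫ wordι X [k]

lemma letterMul_eq (k : K) :
    letterMul (P := P) (X := X) k = letterι k ▷ presObj P X ≫ μ := by
  have h : wordι X [k] ▷ presObj P X ≫ μ = wordMul (P := P) [k] := wordι_presMul [k]
  rw [letterι, comp_whiskerRight_assoc, h, wordMul, wordMul]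
  simp

lemma wordι_cons (k : K) (w : List K) :
    wordι (P := P) X (k :: w) = (letterι k ⊗ₘ wordι X w) ≫ μ := by
  rw [← wordι_letterMul, letterMul_eq, whisker_exchange_assoc, tensorHom_def_assoc]

lemma letterι_mul_letterι (k k' : K) :
    (letterι k ⊗ₘ letterι k') ≫ μ =
      (X.obj k).X ◁ (ρ_ (X.obj k').X).inv ≫ wordι (P := P) X [k, k'] := by
  rw [wordι_cons k [k'], ← id_tensorHom, tensorHom_comp_tensorHom_assoc, Category.id_comp]
  rfl

/-- This and the next three lemmas are the defining relations read off at the empty right context.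
-/
lemma one_letterι (k : K) : η ≫ letterι (P := P) (X := X) k = η := by
  refine Eq.trans ?_ (interp_wordι (X := X) (.one (P := P) k []))
  rw [MonRel.interp, letterι, rightUnitor_inv_naturality_assoc, Category.assoc, unitors_inv_equal]

lemma mul_letterι (k : K) :
    μ ≫ letterι (P := P) (X := X) k = (letterι k ⊗ₘ letterι k) ≫ μ := by
  rw [letterι_mul_letterι, ← interp_wordι (.mul k []), MonRel.interp, letterι,
    rightUnitor_inv_naturality_assoc]
  simp

lemma map_letterι {k k' : K} (g : k ⟶ k') :
    (X.map g).hom ≫ letterι (P := P) (X := X) k' = letterι k := by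
  rw [letterι, letterι, ← interp_wordι (.map g []), MonRel.interp, rightUnitor_inv_naturality_assoc]

lemma commuting_letterι {k k' : K} (h : P k k') :
    Commuting (letterι (P := P) (X := X) k) (letterι k') := by
  unfold Commuting
  rw [letterι_mul_letterι, letterι_mul_letterι, ← interp_wordι (.swap h []), MonRel.interp]
  simp

/-- The inclusion of a generating monoid. -/
noncomputable def presι (k : K) : X.obj k ⟶ presMon P X :=
  Mon.Hom.mk' (N := presMon P X) (letterι k) (one_letterι k) (mul_letterι k)

lemma map_presι {k k' : K} (g : k ⟶ k') : X.map g ≫ presι (P := P) k' = presι k := by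
  ext
  exact map_letterι g

lemma commuting_presι {k k' : K} (h : P k k') :
    Commuting (presι (P := P) (X := X) k).hom (presι (P := P) (X := X) k').hom :=
  commuting_letterι h

/-! ### The universal property of the presented monoid -/

variable {N : Mon M}

/-- The product in a monoid of the values of the letters of a word. -/
def prodWord (s : ∀ k, X.obj k ⟶ N) : ∀ w : List K, tensWord X.obj w ⟶ N.X
  | [] => η
  | k :: w => ((s k).hom ⊗ₘ prodWord s w) ≫ μ

lemma interp_prodWord (s : ∀ k, X.obj k ⟶ N)
    (hs : ∀ ⦃k k' : K⦄ (g : k ⟶ k'), X.map g ≫ s k' = s k)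
    (hP : ∀ ⦃k k' : K⦄, P k k' → Commuting (s k).hom (s k').hom) {w w' : List K}
    (r : MonRel P w w') : r.interp X ≫ prodWord s w' = prodWord s w := by
  induction r with
  | mul k w =>
    rw [MonRel.interp, prodWord, prodWord, prodWord, hom_mul_assoc, ← IsMonHom.mul_hom,
      Category.assoc, ← tensorHom_id, tensorHom_comp_tensorHom_assoc, Category.id_comp]
  | one k w =>
    rw [MonRel.interp, prodWord, Category.assoc, ← tensorHom_id, tensorHom_comp_tensorHom_assoc,
      Category.id_comp, IsMonHom.one_hom]
    exact leftUnitor_inv_one_tensor_mul _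
  | map g w =>
    rw [MonRel.interp, prodWord, prodWord, ← tensorHom_id, tensorHom_comp_tensorHom_assoc,
      Category.id_comp, ← hs g, Mon.comp_hom']
  | swap h w =>
    have := hP h
    unfold Commuting at this
    rw [MonRel.interp, prodWord, prodWord, prodWord, prodWord, hom_mul_assoc, hom_mul_assoc, this]
    simp only [Category.assoc, Iso.hom_inv_id_assoc]
    rw [← tensorHom_id, tensorHom_comp_tensorHom_assoc, Category.id_comp]
  | cons k r ih =>
    rw [MonRel.interp, prodWord, prodWord, ← ih, ← id_tensorHom, tensorHom_comp_tensorHom_assoc,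
      Category.id_comp]

/-- Compatibility with left multiplication by one letter is enough: induction on the word gives
compatibility with left multiplication by words, hence multiplicativity. -/
lemma wordMul_comp (f : presObj P X ⟶ N.X) (h₁ : wordι X [] ≫ f = η)
    (hf : ∀ k w, wordι X (k :: w) ≫ f = (letterι k ≫ f ⊗ₘ wordι X w ≫ f) ≫ μ)
    (w : List K) : wordMul w ≫ f = (wordι X w ≫ f ⊗ₘ f) ≫ μ := by
  induction w with
  | nil => rw [wordMul, h₁, MonObj.one_mul_hom]
  | cons k w ih =>
    have h : letterMul k ≫ f = (letterι k ≫ f ⊗ₘ f) ≫ μ := by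
      apply whiskerLeft_presObj_hom_ext
      intro v
      rw [reassoc_of% wordι_letterMul, hf, ← id_tensorHom, tensorHom_comp_tensorHom_assoc,
        Category.id_comp]
    rw [wordMul, Category.assoc, Category.assoc, h, ← id_tensorHom, tensorHom_comp_tensorHom_assoc,
      Category.id_comp, ih, hom_mul_assoc, Iso.hom_inv_id_assoc, hf]

/-- The morphism from the presented monoid given by its universal property. -/
noncomputable def presMonDesc (s : ∀ k, X.obj k ⟶ N)
    (hs : ∀ ⦃k k' : K⦄ (g : k ⟶ k'), X.map g ≫ s k' = s k)
    (hP : ∀ ⦃k k' : K⦄, P k k' → Commuting (s k).hom (s k').hom) : presMon P X ⟶ N :=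
  Mon.Hom.mk' (M := presMon P X) (presDesc (prodWord s) fun _ _ => interp_prodWord s hs hP)
    (one_f := wordι_presDesc _ _ [])
    (mul_f := by
      have h : ∀ k : K, letterι k ≫ presDesc (prodWord s) (fun _ _ => interp_prodWord s hs hP) =
          (s k).hom := by
        intro k
        rw [letterι, Category.assoc, wordι_presDesc]
        exact rightUnitor_inv_tensor_one_mul _
      apply presObj_whiskerRight_hom_ext
      intro w
      refine ((reassoc_of% (wordι_presMul w)) _).trans ((wordMul_comp _ ?_ ?_ w).trans ?_)
      · exact wordι_presDesc _ _ []
      · intro k w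
        rw [h, wordι_presDesc, wordι_presDesc, prodWord]
      · rw [← tensorHom_id, tensorHom_comp_tensorHom_assoc, Category.id_comp])

lemma presι_presMonDesc (s : ∀ k, X.obj k ⟶ N)
    (hs : ∀ ⦃k k' : K⦄ (g : k ⟶ k'), X.map g ≫ s k' = s k)
    (hP : ∀ ⦃k k' : K⦄, P k k' → Commuting (s k).hom (s k').hom) (k : K) :
    presι k ≫ presMonDesc (P := P) s hs hP = s k := by
  ext
  refine (Category.assoc _ _ _).trans ((congrArg ((ρ_ _).inv ≫ ·)
    (wordι_presDesc _ (fun _ _ => interp_prodWord s hs hP) _)).trans ?_)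
  exact rightUnitor_inv_tensor_one_mul _

lemma wordι_cons_comp (f : presMon P X ⟶ N) (k : K) (w : List K) :
    wordι X (k :: w) ≫ f.hom = ((presι k ≫ f).hom ⊗ₘ wordι X w ≫ f.hom) ≫ μ := by
  rw [wordι_cons, Mon.comp_hom', ← tensorHom_comp_tensorHom, Category.assoc, Category.assoc,
    ← IsMonHom.mul_hom]
  rfl

lemma presMon_hom_ext {f g : presMon P X ⟶ N} (h : ∀ k, presι k ≫ f = presι k ≫ g) : f = g := by
  ext
  apply presObj_hom_ext
  intro w
  induction w with
  | nil => exact (IsMonHom.one_hom f.hom).trans (IsMonHom.one_hom g.hom).symm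
  | cons k w ih => rw [wordι_cons_comp, wordι_cons_comp, h, ih]

/-- A morphism commutes with the presented monoid as soon as it commutes with the generators. -/
lemma commuting_presMon (f : presMon P X ⟶ N) {y : M} (g : y ⟶ N.X)
    (h : ∀ k, Commuting (presι k ≫ f).hom g) : Commuting f.hom g := by
  have key : ∀ w, Commuting (wordι X w ≫ f.hom) g := by
    intro w
    induction w with
    | nil =>
      have : wordι X [] ≫ f.hom = η := IsMonHom.one_hom f.hom
      rw [this]
      exact Commuting.one_left g
    | cons k w ih =>
      rw [wordι_cons_comp]
      exact (h k).mul_left ih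
  apply presObj_whiskerRight_hom_ext
  intro w
  have := key w
  unfold Commuting at this
  rw [BraidedCategory.braiding_naturality_left_assoc, ← tensorHom_id, ← id_tensorHom,
    tensorHom_comp_tensorHom_assoc, tensorHom_comp_tensorHom_assoc, Category.id_comp, this]

end PresentedMonoid

/-! ### Extension of diagrams of monoids along a functor, with commutation relations -/

section Extension

variable {M : Type u} [Category.{v} M] [MonoidalCategory M] [SymmetricCategory M]
variable {C D : Type v} [SmallCategory C] [SmallCategory D]

/-- A diagram of monoids in which orthogonal pairs of morphisms have commuting images. -/
def PerpCommuting (perp : OrthRel D) (F : D ⥤ Mon M) : Prop :=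
  ∀ ⦃c₁ c₂ t : D⦄ (f₁ : c₁ ⟶ t) (f₂ : c₂ ⟶ t), perp.rel f₁ f₂ →
    Commuting (F.map f₁).hom (F.map f₂).hom

variable [MonoidalClosed M] [HasColimits M] (perp : OrthRel D) (j : C ⥤ D) (G : C ⥤ Mon M)

/-- Orthogonality of the structure morphisms of two objects over `t`. -/
def overRel (t : D) (k k' : CostructuredArrow j t) : Prop := perp.rel k.hom k'.hom

/-- The monoid at `t` of the extension of `G` along `j`. -/
noncomputable def extObj (t : D) : Mon M :=
  presMon (overRel perp j t) (CostructuredArrow.proj j t ⋙ G)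

variable {j G}

/-- The inclusion of the monoid at `c`, along `f : j.obj c ⟶ t`. -/
noncomputable def extι {c : C} {t : D} (f : j.obj c ⟶ t) : G.obj c ⟶ extObj perp j G t :=
  presι (P := overRel perp j t) (X := CostructuredArrow.proj j t ⋙ G) (CostructuredArrow.mk f)

variable {perp}

lemma map_extι {c c' : C} {t : D} (g : c ⟶ c') (f : j.obj c' ⟶ t) :
    G.map g ≫ extι perp f = extι perp (j.map g ≫ f) :=
  map_presι (P := overRel perp j t) (X := CostructuredArrow.proj j t ⋙ G)
    (CostructuredArrow.homMk g : CostructuredArrow.mk (j.map g ≫ f) ⟶ CostructuredArrow.mk f)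

lemma commuting_extι {c c' : C} {t : D} {f : j.obj c ⟶ t} {f' : j.obj c' ⟶ t}
    (h : perp.rel f f') :
    Commuting (extι (G := G) perp f).hom (extι (G := G) perp f').hom :=
  commuting_presι (P := overRel perp j t) (X := CostructuredArrow.proj j t ⋙ G)
    (k := CostructuredArrow.mk f) (k' := CostructuredArrow.mk f') h

lemma extObj_hom_ext {t : D} {N : Mon M} {f g : extObj perp j G t ⟶ N}
    (h : ∀ {c : C} (k : j.obj c ⟶ t), extι perp k ≫ f = extι perp k ≫ g) : f = g :=
  presMon_hom_ext fun k => h k.hom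

lemma commuting_extObj {t : D} {N : Mon M} {y : M} {f : extObj perp j G t ⟶ N} {g : y ⟶ N.X}
    (h : ∀ {c : C} (k : j.obj c ⟶ t), Commuting (extι perp k ≫ f).hom g) : Commuting f.hom g :=
  commuting_presMon f g fun k => h k.hom

/-- The universal property of the monoid at `t`. -/
noncomputable def extObjDesc {t : D} {N : Mon M} (s : ∀ {c : C}, (j.obj c ⟶ t) → (G.obj c ⟶ N))
    (hs : ∀ ⦃c c' : C⦄ (g : c ⟶ c') (f : j.obj c' ⟶ t), G.map g ≫ s f = s (j.map g ≫ f))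
    (hP : ∀ ⦃c c' : C⦄ ⦃f : j.obj c ⟶ t⦄ ⦃f' : j.obj c' ⟶ t⦄, perp.rel f f' →
      Commuting (s f).hom (s f').hom) : extObj perp j G t ⟶ N :=
  presMonDesc (P := overRel perp j t) (X := CostructuredArrow.proj j t ⋙ G) (fun k => s k.hom)
    (fun _ _ g => (hs g.left _).trans (congrArg s (CostructuredArrow.w g))) fun _ _ h => hP h

lemma extι_extObjDesc {t : D} {N : Mon M} (s : ∀ {c : C}, (j.obj c ⟶ t) → (G.obj c ⟶ N))
    (hs : ∀ ⦃c c' : C⦄ (g : c ⟶ c') (f : j.obj c' ⟶ t), G.map g ≫ s f = s (j.map g ≫ f))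
    (hP : ∀ ⦃c c' : C⦄ ⦃f : j.obj c ⟶ t⦄ ⦃f' : j.obj c' ⟶ t⦄, perp.rel f f' →
      Commuting (s f).hom (s f').hom) {c : C} (k : j.obj c ⟶ t) :
    extι perp k ≫ extObjDesc s hs hP = s k :=
  presι_presMonDesc (P := overRel perp j t) (X := CostructuredArrow.proj j t ⋙ G)
    (fun k => s k.hom) _ _ (CostructuredArrow.mk k)

/-- Functoriality of the extension. -/
noncomputable def extMap {t t' : D} (h : t ⟶ t') : extObj perp j G t ⟶ extObj perp j G t' :=
  extObjDesc (fun f => extι perp (f ≫ h))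
    (fun _ _ g f => by rw [map_extι, Category.assoc])
    (fun _ _ _ _ hf => commuting_extι (perp.postcomp h hf))

lemma extι_extMap {c : C} {t t' : D} (f : j.obj c ⟶ t) (h : t ⟶ t') :
    extι perp f ≫ extMap h = extι (G := G) perp (f ≫ h) :=
  extι_extObjDesc _ _ _ _

variable (perp j G)

/-- The extension of a diagram of monoids along `j` that is universal among those with commuting
orthogonal pairs. -/
noncomputable abbrev ext : D ⥤ Mon M where
  obj t := extObj perp j G t
  map h := extMap h
  map_id t := by
    apply extObj_hom_ext
    intro c k
    rw [extι_extMap, Category.comp_id, Category.comp_id]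
  map_comp h h' := by
    apply extObj_hom_ext
    intro c k
    rw [extι_extMap, reassoc_of% extι_extMap, extι_extMap, Category.assoc]

variable {perp j G}

lemma extι_map {c : C} {t t' : D} (f : j.obj c ⟶ t) (h : t ⟶ t') :
    extι perp f ≫ (ext perp j G).map h = extι perp (f ≫ h) :=
  extι_extMap f h

variable (perp j G) in
-- Both sides reduce to generators `k`, `l`. What remains is the commutation of the generators at `l
-- ≫ f₁` and `k ≫ f₂`, which are orthogonal by stability under precomposition.
lemma perpCommuting_ext : PerpCommuting perp (ext perp j G) := by
  intro c₁ c₂ t f₁ f₂ hf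
  apply commuting_extObj
  intro a k
  apply Commuting.symm
  apply commuting_extObj
  intro b l
  rw [extι_map, extι_map]
  exact commuting_extι (perp.precomp l k (perp.symm hf))

variable (perp j G) in
/-- The unit of the extension. -/
noncomputable def extUnit : G ⟶ j ⋙ ext perp j G where
  app c := extι perp (𝟙 (j.obj c))
  naturality c c' g := by
    rw [Functor.comp_map, extι_map, map_extι, Category.comp_id, Category.id_comp]

/-- The universal property of the extension. -/
noncomputable def extDesc {F : D ⥤ Mon M} (hF : PerpCommuting perp F) (φ : G ⟶ j ⋙ F) :
    ext perp j G ⟶ F where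
  app t := extObjDesc (fun {c} f => φ.app c ≫ F.map f)
    (fun _ _ g f => by
      rw [← Category.assoc, φ.naturality, Functor.comp_map, Category.assoc, F.map_comp])
    (fun _ _ _ _ h => by
      rw [Mon.comp_hom', Mon.comp_hom']
      exact (((hF _ _ h).precomp _).symm.precomp _).symm)
  naturality t t' h := by
    apply extObj_hom_ext
    intro c k
    rw [← Category.assoc, extι_map, extι_extObjDesc, reassoc_of% extι_extObjDesc, F.map_comp,
      Category.assoc]

lemma extι_extDesc {F : D ⥤ Mon M} (hF : PerpCommuting perp F) (φ : G ⟶ j ⋙ F) {c : C} {t : D}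
    (k : j.obj c ⟶ t) : extι perp k ≫ (extDesc hF φ).app t = φ.app c ≫ F.map k :=
  extι_extObjDesc _ _ _ k

lemma extUnit_extDesc {F : D ⥤ Mon M} (hF : PerpCommuting perp F) (φ : G ⟶ j ⋙ F) :
    extUnit perp j G ≫ Functor.whiskerLeft j (extDesc hF φ) = φ := by
  ext1
  funext c
  refine (extι_extDesc hF φ _).trans ?_
  rw [F.map_id]
  exact Category.comp_id _

/-- The generator at `k : j.obj c ⟶ t` is the image under `k` of the generator at the identity of
`j.obj c`, so naturality determines everything from the unit. -/
lemma ext_natTrans_ext {F : D ⥤ Mon M} {φ ψ : ext perp j G ⟶ F}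
    (h : extUnit perp j G ≫ Functor.whiskerLeft j φ = extUnit perp j G ≫ Functor.whiskerLeft j ψ) :
    φ = ψ := by
  ext1
  funext t
  apply extObj_hom_ext
  intro c k
  have h' : extι perp (𝟙 (j.obj c)) ≫ φ.app (j.obj c) = extι perp (𝟙 (j.obj c)) ≫ ψ.app (j.obj c) :=
    congrArg (fun α => NatTrans.app α c) h
  have key : extι perp k = extι perp (𝟙 (j.obj c)) ≫ (ext perp j G).map k := by
    rw [extι_map, Category.id_comp]
  rw [key, Category.assoc, Category.assoc, φ.naturality, ψ.naturality, ← Category.assoc, h',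
    Category.assoc]

/-- Along a full and faithful functor, the extension restricts to the given diagram. -/
lemma isIso_extUnit [j.Full] [j.Faithful] (hG : PerpCommuting (perp.pullback j) G) :
    IsIso (extUnit perp j G) := by
  have : ∀ c, IsIso ((extUnit perp j G).app c) := by
    intro c
    have hs : ∀ ⦃b b' : C⦄ (g : b ⟶ b') (f : j.obj b' ⟶ j.obj c),
        G.map g ≫ G.map (j.preimage f) = G.map (j.preimage (j.map g ≫ f)) := by
      intro b b' g f
      rw [← G.map_comp]
      congr 1
      apply j.map_injective
      simp only [j.map_comp, j.map_preimage]
    have hP : ∀ ⦃b b' : C⦄ ⦃f : j.obj b ⟶ j.obj c⦄ ⦃f' : j.obj b' ⟶ j.obj c⦄, perp.rel f f' →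
        Commuting (G.map (j.preimage f)).hom (G.map (j.preimage f')).hom := by
      intro b b' f f' h
      apply hG
      change perp.rel _ _
      rw [j.map_preimage, j.map_preimage]
      exact h
    -- The candidate inverse sends the generator at `f` to `G` of the unique preimage of `f`.
    refine ⟨extObjDesc (fun f => G.map (j.preimage f)) hs hP, ?_, ?_⟩
    · refine (extι_extObjDesc _ _ _ _).trans ?_
      rw [j.preimage_id, G.map_id]
    · apply extObj_hom_ext
      intro b k
      refine ((reassoc_of% (extι_extObjDesc _ _ _ _)) _).trans ?_
      refine (map_extι _ _).trans ?_
      rw [j.map_preimage, Category.comp_id]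
      exact (Category.comp_id _).symm
  exact NatIso.isIso_of_isIso_app _

end Extension

/-! ### Coherence for permutations of tensor factors -/

section Coherence

variable {M : Type u} [Category.{v} M] [MonoidalCategory M]

/-- The transposition of the first two of three factors. -/
def swapHead [BraidedCategory M] (A B T : M) : A ⊗ (B ⊗ T) ⟶ B ⊗ (A ⊗ T) :=
  (α_ A B T).inv ≫ ((β_ A B).hom ▷ T) ≫ (α_ B A T).hom

lemma swapHead_naturality [BraidedCategory M] {A A' B B' T T' : M} (f : A ⟶ A') (g : B ⟶ B')
    (h : T ⟶ T') :
    (f ⊗ₘ (g ⊗ₘ h)) ≫ swapHead A' B' T' = swapHead A B T ≫ (g ⊗ₘ (f ⊗ₘ h)) := by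
  simp only [swapHead, Category.assoc]
  rw [associator_inv_naturality_assoc, ← tensorHom_id, tensorHom_comp_tensorHom_assoc,
    Category.comp_id, BraidedCategory.braiding_naturality, ← associator_naturality,
    ← tensorHom_id, tensorHom_comp_tensorHom_assoc, Category.id_comp]

lemma swapHead_naturality_right [BraidedCategory M] {A B T T' : M} (h : T ⟶ T') :
    A ◁ B ◁ h ≫ swapHead A B T' = swapHead A B T ≫ B ◁ A ◁ h := by
  simpa only [id_tensorHom] using swapHead_naturality (𝟙 A) (𝟙 B) h

lemma swapHead_swapHead [SymmetricCategory M] (A B T : M) :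
    swapHead A B T ≫ swapHead B A T = 𝟙 _ := by
  simp only [swapHead, Category.assoc, Iso.hom_inv_id_assoc]
  rw [← comp_whiskerRight_assoc, SymmetricCategory.symmetry]
  simp

/-- The Yang–Baxter equation for three factors, with a spectator `T` tensored on the right. -/
lemma swapHead_yang_baxter [BraidedCategory M] (A B K T : M) :
    swapHead A B (K ⊗ T) ≫ B ◁ swapHead A K T ≫ swapHead B K (A ⊗ T) =
      A ◁ swapHead B K T ≫ swapHead A K (B ⊗ T) ≫ K ◁ swapHead A B T := by
  have h := BraidedCategory.yang_baxter A B K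
  have h' := congrArg (fun f : A ⊗ (B ⊗ K) ⟶ K ⊗ (B ⊗ A) =>
    A ◁ (α_ B K T).inv ≫ (α_ A (B ⊗ K) T).inv ≫ f ▷ T ≫ (α_ K (B ⊗ A) T).hom ≫
      K ◁ (α_ B A T).hom) h
  refine Eq.trans ?_ (h'.trans ?_)
  · simp only [swapHead]
    monoidal
  · simp only [swapHead]
    monoidal

variable {ι : Type}

/-- Removal of an entry from a list. -/
inductive Extract (i : ι) : List ι → List ι → Type
  | head (l : List ι) : Extract i (i :: l) l
  | tail (j : ι) {l l' : List ι} : Extract i l l' → Extract i (j :: l) (j :: l')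

/-- Moving a tensor factor to the front. -/
def Extract.braid [BraidedCategory M] (X : ι → M) {i : ι} :
    ∀ {l l' : List ι}, Extract i l l' → (tens X l ⟶ X i ⊗ tens X l')
  | _, _, .head l => 𝟙 (X i ⊗ tens X l)
  | _, _, .tail (l' := l') j p => X j ◁ p.braid X ≫ swapHead (X j) (X i) (tens X l')

/-- Rearrangement of a list by successively choosing the next entry. -/
inductive Arrange : List ι → List ι → Type
  | nil : Arrange [] []
  | cons {i : ι} {l l' m : List ι} : Extract i l l' → Arrange l' m → Arrange l (i :: m)

/-- The permutation of tensor factors along an arrangement. -/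
def Arrange.braid [BraidedCategory M] (X : ι → M) :
    ∀ {l m : List ι}, Arrange l m → (tens X l ⟶ tens X m)
  | _, _, .nil => 𝟙 (𝟙_ M)
  | _, _, .cons (i := i) p s => p.braid X ≫ X i ◁ s.braid X

lemma Rearr.braid_swap [SymmetricCategory M] (X : ι → M) (i j : ι) (l : List ι) :
    (Rearr.swap i j l).braid X = swapHead (X i) (X j) (tens X l) := rfl

lemma Rearr.exists_refl [SymmetricCategory M] (X : ι → M) :
    ∀ l : List ι, ∃ w : Rearr l l, w.braid X = 𝟙 (tens X l)
  | [] => ⟨.nil, rfl⟩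
  | i :: l => by
    obtain ⟨w, hw⟩ := exists_refl X l
    refine ⟨.cons i w, ?_⟩
    rw [Rearr.braid, hw]
    exact whiskerLeft_id (X i) (tens X l)

lemma Arrange.exists_refl [SymmetricCategory M] (X : ι → M) :
    ∀ l : List ι, ∃ w : Arrange l l, w.braid X = 𝟙 (tens X l)
  | [] => ⟨.nil, rfl⟩
  | i :: l => by
    obtain ⟨w, hw⟩ := exists_refl X l
    refine ⟨.cons (.head l) w, ?_⟩
    rw [Arrange.braid, hw, Extract.braid, whiskerLeft_id]
    exact Category.comp_id _

/-- Pulling an entry to the front after a rearrangement is the same as pulling it to the front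
before, and then rearranging the remainder. For a transposition the three cases use nothing, the
symmetry of the braiding, and Yang–Baxter. -/
lemma Rearr.exists_extract [SymmetricCategory M] (X : ι → M) {l l' : List ι} (w : Rearr l l')
    {k : ι} {m : List ι} (p : Extract k l' m) :
    ∃ (m' : List ι) (p' : Extract k l m') (w' : Rearr m' m),
      w.braid X ≫ p.braid X = p'.braid X ≫ X k ◁ w'.braid X := by
  induction w generalizing m with
  | nil => cases p
  | cons i w ih =>
    cases p with
    | head => 
      refine ⟨_, .head _, w, ?_⟩
      simp only [Rearr.braid, Extract.braid]
      exact (Category.comp_id _).trans (Category.id_comp _).symm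
    | tail _ p =>
      obtain ⟨m', p', w', h⟩ := ih p
      refine ⟨_, .tail i p', .cons i w', ?_⟩
      simp only [Rearr.braid, Extract.braid, tens, Category.assoc]
      rw [← swapHead_naturality_right, ← whiskerLeft_comp_assoc, ← whiskerLeft_comp_assoc, h]
  | swap i j l =>
    cases p with
    | head =>
      obtain ⟨w, hw⟩ := Rearr.exists_refl X (i :: l)
      refine ⟨_, .tail i (.head l), w, ?_⟩
      rw [hw]
      simp only [Rearr.braid, Extract.braid, tens, Category.comp_id, whiskerLeft_id,
        Category.id_comp]
      rfl
    | tail _ p =>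
      cases p with
      | head =>
        obtain ⟨w, hw⟩ := Rearr.exists_refl X (j :: l)
        refine ⟨_, .head _, w, ?_⟩
        rw [hw]
        simp only [Rearr.braid, Extract.braid, tens, Category.comp_id, whiskerLeft_id,
          Category.id_comp]
        exact swapHead_swapHead _ _ _
      | tail _ p =>
        refine ⟨_, .tail i (.tail j p), .swap i j _, ?_⟩
        simp only [Rearr.braid_swap, Extract.braid, tens, whiskerLeft_comp, Category.assoc]
        rw [← swapHead_yang_baxter, ← reassoc_of% swapHead_naturality_right]
  | trans w₁ w₂ ih₁ ih₂ =>
    obtain ⟨m', p', w', h⟩ := ih₂ p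
    obtain ⟨m'', p'', w'', h'⟩ := ih₁ p'
    refine ⟨m'', p'', .trans w'' w', ?_⟩
    simp only [Rearr.braid, Category.assoc]
    rw [h, whiskerLeft_comp, ← Category.assoc, h', Category.assoc]

lemma Rearr.exists_arrange_nil [SymmetricCategory M] (X : ι → M) {l l' : List ι} (w : Rearr l l')
    (h : l' = []) : ∃ s : Arrange l l', w.braid X = s.braid X := by
  induction w with
  | nil => exact ⟨.nil, rfl⟩
  | cons | swap => cases h
  | trans w₁ w₂ ih₁ ih₂ =>
    obtain ⟨s₂, h₂⟩ := ih₂ h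
    subst h
    cases s₂ with
    | nil =>
      obtain ⟨s₁, h₁⟩ := ih₁ rfl
      refine ⟨s₁, ?_⟩
      rw [Rearr.braid, h₁, h₂]
      exact Category.comp_id _

/-- Normal form: repeated extraction turns any word of transpositions into a selection sort without
changing the resulting morphism. -/
lemma Rearr.exists_arrange [SymmetricCategory M] (X : ι → M) {l' m : List ι} (s : Arrange l' m) :
    ∀ {l : List ι} (w : Rearr l l'), ∃ s' : Arrange l m, w.braid X ≫ s.braid X = s'.braid X := by
  induction s with
  | nil =>
    intro l w
    obtain ⟨s', h⟩ := w.exists_arrange_nil X rfl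
    exact ⟨s', (Category.comp_id _).trans h⟩
  | cons p s ih =>
    intro l w
    obtain ⟨m', p', w', h⟩ := w.exists_extract X p
    obtain ⟨s', h'⟩ := ih w'
    refine ⟨.cons p' s', ?_⟩
    simp only [Arrange.braid, tens]
    rw [← Category.assoc, h, Category.assoc, ← whiskerLeft_comp, h']

lemma Extract.mem {i : ι} {l l' : List ι} (p : Extract i l l') : i ∈ l := by
  induction p with
  | head l => simp
  | tail j p ih => exact List.mem_cons_of_mem _ ih

lemma Extract.nodup {i : ι} {l l' : List ι} (p : Extract i l l') (h : l.Nodup) : l'.Nodup := by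
  have : l'.Sublist l := by
    induction p with
    | head l => simp
    | tail j p ih => exact (ih (List.nodup_cons.mp h).2).cons_cons _
  exact h.sublist this

/-- In a list without repetitions an entry has only one position. The equality is in a sigma type
because the remaining list is part of the output. -/
lemma Extract.unique {i : ι} {l l₁ : List ι} (p : Extract i l l₁) (h : l.Nodup) :
    ∀ {l₂ : List ι} (p' : Extract i l l₂),
      (⟨l₁, p⟩ : Σ m, Extract i l m) = ⟨l₂, p'⟩ := by
  induction p with
  | head l =>
    intro l₂ p'
    cases p' with
    | head => rfl
    | tail _ p' => exact absurd p'.mem (List.nodup_cons.mp h).1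
  | tail j p ih =>
    intro l₂ p'
    cases p' with
    | head => exact absurd p.mem (List.nodup_cons.mp h).1
    | tail _ p' =>
      have := ih (List.nodup_cons.mp h).2 p'
      cases this
      rfl

lemma Arrange.unique {l m : List ι} (s s' : Arrange l m) (h : l.Nodup) : s = s' := by
  induction s with
  | nil => cases s'; rfl
  | cons p s ih =>
    cases s' with
    | cons p' s' =>
      have := p.unique h p'
      cases this
      rw [ih s' (p.nodup h)]

/-- Coherence: the permutation of tensor factors does not depend on the way it is written as a
composite of transpositions. -/
lemma Rearr.braid_eq [SymmetricCategory M] (X : ι → M) {l l' : List ι} (h : l.Nodup)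
    (w w' : Rearr l l') : w.braid X = w'.braid X := by
  -- Precomposing the trivial arrangement with `w` and with `w'` gives two arrangements from `l` to
  -- `l'`; there is only one.
  obtain ⟨s, hs⟩ := Arrange.exists_refl X l'
  obtain ⟨s₁, h₁⟩ := Rearr.exists_arrange X s w
  obtain ⟨s₂, h₂⟩ := Rearr.exists_arrange X s w'
  rw [hs, Category.comp_id] at h₁ h₂
  rw [h₁, h₂, s₁.unique s₂ h]

end Coherence

/-! ### Products of families in a monoid, and rearrangements of blocks -/

section Blocks

local notation "η" => MonObj.one
local notation "μ" => MonObj.mul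

variable {M : Type u} [Category.{v} M] [MonoidalCategory M]

section Product

variable {ι κ : Type} {X Y : ι → M} {N N' : M} [MonObj N] [MonObj N']

/-- The product in a monoid of a family of morphisms, in the order given by a list. -/
def tensProd (φ : ∀ i, X i ⟶ N) : ∀ l : List ι, tens X l ⟶ N
  | [] => η
  | i :: l => (φ i ⊗ₘ tensProd φ l) ≫ μ

lemma tensProd_append (φ : ∀ i, X i ⟶ N) (l l' : List ι) :
    tensProd φ (l ++ l') =
      (tensAppend X l l').hom ≫ (tensProd φ l ⊗ₘ tensProd φ l') ≫ μ := by
  induction l with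
  | nil =>
    simp only [tensProd, tensAppend, tens, List.nil_append, Iso.symm_hom]
    exact (leftUnitor_inv_one_tensor_mul _).symm
  | cons i l ih =>
    simp only [tensProd, tensAppend, tens, List.cons_append, Iso.trans_hom, Iso.symm_hom,
      whiskerLeftIso_hom, Category.assoc]
    rw [← hom_mul_assoc, ← id_tensorHom, tensorHom_comp_tensorHom_assoc, Category.id_comp, ih]

lemma tensProd_map (φ : ∀ i, X i ⟶ N) (g : κ → ι) (l : List κ) :
    tensProd φ (l.map g) = (tensReindex g X l).hom ≫ tensProd (fun k => φ (g k)) l := by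
  induction l with
  | nil => exact (Category.id_comp _).symm
  | cons i l ih =>
    change (φ (g i) ⊗ₘ tensProd φ (l.map g)) ≫ μ = X (g i) ◁ (tensReindex g X l).hom ≫
      (φ (g i) ⊗ₘ tensProd (fun k => φ (g k)) l) ≫ μ
    rw [← id_tensorHom, tensorHom_comp_tensorHom_assoc, Category.id_comp, ih]

lemma tensMap_tensProd (f : ∀ i, X i ⟶ Y i) (φ : ∀ i, Y i ⟶ N) (l : List ι) :
    tensMap f l ≫ tensProd φ l = tensProd (fun i => f i ≫ φ i) l := by
  induction l with
  | nil => exact Category.id_comp _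
  | cons i l ih =>
    simp only [tensProd, tensMap, tens]
    rw [tensorHom_comp_tensorHom_assoc, ih]

lemma tensProd_comp (φ : ∀ i, X i ⟶ N) (ψ : N ⟶ N') [IsMonHom ψ] (l : List ι) :
    tensProd φ l ≫ ψ = tensProd (fun i => φ i ≫ ψ) l := by
  induction l with
  | nil => exact IsMonHom.one_hom ψ
  | cons i l ih =>
    simp only [tensProd, tens, Category.assoc]
    rw [IsMonHom.mul_hom, tensorHom_comp_tensorHom_assoc, ih]

end Product

/-! ### Rearrangements of mapped and concatenated lists -/

section Words

variable [SymmetricCategory M] {ι κ : Type}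

lemma Rearr.braid_naturality {X Y : ι → M} (f : ∀ i, X i ⟶ Y i) {l l' : List ι} (w : Rearr l l') :
    w.braid X ≫ tensMap f l' = tensMap f l ≫ w.braid Y := by
  induction w with
  | nil => rfl
  | cons i w ih =>
    simp only [Rearr.braid, tensMap, tens]
    rw [← id_tensorHom, ← id_tensorHom, tensorHom_comp_tensorHom, tensorHom_comp_tensorHom, ih,
      Category.id_comp, Category.comp_id]
  | swap i j l =>
    simp only [braid_swap, tensMap, tens]
    rw [swapHead_naturality]
  | trans w₁ w₂ ih₁ ih₂ =>
    simp only [Rearr.braid, Category.assoc]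
    rw [ih₂, ← Category.assoc, ih₁, Category.assoc]

/-- The image of a rearrangement under a map of indices. -/
def Rearr.map (g : κ → ι) : ∀ {l l' : List κ}, Rearr l l' → Rearr (l.map g) (l'.map g)
  | _, _, .nil => .nil
  | _, _, .cons i w => .cons (g i) (w.map g)
  | _, _, .swap i j l => .swap (g i) (g j) (l.map g)
  | _, _, .trans w w' => .trans (w.map g) (w'.map g)

lemma Rearr.map_braid (X : ι → M) (g : κ → ι) {l l' : List κ} (w : Rearr l l') :
    (w.map g).braid X ≫ (tensReindex g X l').hom =
      (tensReindex g X l).hom ≫ w.braid (fun k => X (g k)) := by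
  induction w with
  | nil => rfl
  | cons i w ih =>
    change X (g i) ◁ (w.map g).braid X ≫ X (g i) ◁ (tensReindex g X _).hom =
      X (g i) ◁ (tensReindex g X _).hom ≫ X (g i) ◁ w.braid _
    rw [← whiskerLeft_comp, ih, whiskerLeft_comp]
  | swap i j l =>
    exact (swapHead_naturality_right (tensReindex g X l).hom).symm
  | trans w₁ w₂ ih₁ ih₂ =>
    simp only [Rearr.braid, Rearr.map, Category.assoc]
    rw [ih₂, ← Category.assoc, ih₁, Category.assoc]

lemma Rearr.exists_append_left (X : ι → M) (l : List ι) {m m' : List ι} (w : Rearr m m') :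
    ∃ w' : Rearr (l ++ m) (l ++ m'), w'.braid X ≫ (tensAppend X l m').hom =
      (tensAppend X l m).hom ≫ tens X l ◁ w.braid X := by
  induction l with
  | nil =>
    refine ⟨w, ?_⟩
    simp only [tensAppend, tens, List.nil_append, Iso.symm_hom]
    exact leftUnitor_inv_naturality _
  | cons i l ih =>
    obtain ⟨w', h⟩ := ih
    refine ⟨.cons i w', ?_⟩
    simp only [Rearr.braid, tensAppend, tens, List.cons_append, Iso.trans_hom, Iso.symm_hom,
      whiskerLeftIso_hom, Category.assoc]
    rw [← whiskerLeft_comp_assoc, h]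
    simp

lemma Rearr.exists_append_right (X : ι → M) {l l' : List ι} (w : Rearr l l') (m : List ι) :
    ∃ w' : Rearr (l ++ m) (l' ++ m), w'.braid X ≫ (tensAppend X l' m).hom =
      (tensAppend X l m).hom ≫ w.braid X ▷ tens X m := by
  induction w with
  | nil =>
    obtain ⟨w', h⟩ := Rearr.exists_refl X m
    refine ⟨w', ?_⟩
    simp only [h, Rearr.braid, tensAppend, tens, List.nil_append, id_whiskerRight]
    exact (Category.id_comp _).trans (Category.comp_id _).symm
  | cons i w ih =>
    obtain ⟨w', h⟩ := ih
    refine ⟨.cons i w', ?_⟩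
    simp only [Rearr.braid, tensAppend, tens, List.cons_append, Iso.trans_hom, Iso.symm_hom,
      whiskerLeftIso_hom, Category.assoc]
    rw [← whiskerLeft_comp_assoc, h]
    simp
  | swap i j l =>
    refine ⟨.swap i j (l ++ m), ?_⟩
    change swapHead (X i) (X j) (tens X (l ++ m)) ≫ X j ◁ (X i ◁ (tensAppend X l m).hom ≫
      (α_ (X i) (tens X l) (tens X m)).inv) ≫ (α_ (X j) (X i ⊗ tens X l) (tens X m)).inv =
      (X i ◁ (X j ◁ (tensAppend X l m).hom ≫ (α_ (X j) (tens X l) (tens X m)).inv) ≫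
        (α_ (X i) (X j ⊗ tens X l) (tens X m)).inv) ≫
          swapHead (X i) (X j) (tens X l) ▷ tens X m
    simp only [whiskerLeft_comp, Category.assoc]
    rw [← reassoc_of% swapHead_naturality_right]
    congr 1
    simp only [swapHead]
    monoidal
  | trans w₁ w₂ ih₁ ih₂ =>
    obtain ⟨w₁', h₁⟩ := ih₁
    obtain ⟨w₂', h₂⟩ := ih₂
    refine ⟨.trans w₁' w₂', ?_⟩
    simp only [Rearr.braid, Category.assoc, comp_whiskerRight]
    rw [h₂, ← Category.assoc, h₁, Category.assoc]

/-- A hexagon: moving past `B ⊗ B'` is moving past `B` and then past `B'`. With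
`swapHead_tensor_left` it reduces an exchange of blocks to exchanges of single entries. -/
lemma swapHead_tensor_right (A B B' T : M) :
    swapHead A (B ⊗ B') T = A ◁ (α_ B B' T).hom ≫ swapHead A B (B' ⊗ T) ≫ B ◁ swapHead A B' T ≫
      (α_ B B' (A ⊗ T)).inv := by
  simp only [swapHead, BraidedCategory.braiding_tensor_right_hom]
  monoidal

lemma swapHead_tensor_left (A A' B T : M) :
    swapHead (A ⊗ A') B T = (α_ A A' (B ⊗ T)).hom ≫ A ◁ swapHead A' B T ≫ swapHead A B (A' ⊗ T) ≫
      B ◁ (α_ A A' T).inv := by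
  simp only [swapHead, BraidedCategory.braiding_tensor_left_hom]
  monoidal

lemma swapHead_unit_left (B T : M) :
    swapHead (𝟙_ M) B T = (λ_ (B ⊗ T)).hom ≫ B ◁ (λ_ T).inv := by
  simp only [swapHead, braiding_tensorUnit_left]
  monoidal

lemma swapHead_unit_right (A T : M) :
    swapHead A (𝟙_ M) T = A ◁ (λ_ T).hom ≫ (λ_ (A ⊗ T)).inv := by
  simp only [swapHead, braiding_tensorUnit_right]
  monoidal

variable {ι κ : Type}

lemma swapHead_cons_aux {A B L T LT LAT : M} (b : A ⊗ LT ⟶ LAT) (f : LAT ⟶ L ⊗ (A ⊗ T))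
    (g : LT ⟶ L ⊗ T) (h : b ≫ f = A ◁ g ≫ swapHead A L T) :
    (swapHead A B LT ≫ B ◁ b) ≫ B ◁ f ≫ (α_ B L (A ⊗ T)).inv =
      A ◁ (B ◁ g ≫ (α_ B L T).inv) ≫ swapHead A (B ⊗ L) T := by
  rw [swapHead_tensor_right, Category.assoc, ← whiskerLeft_comp_assoc, h]
  simp only [whiskerLeft_comp, Category.assoc]
  rw [← reassoc_of% swapHead_naturality_right, whiskerLeft_inv_hom_assoc]

lemma swapHead_append_aux {A L L' T LT L'T U V W : M} (b : U ⟶ V) (b' : A ⊗ V ⟶ W)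
    (f : W ⟶ L' ⊗ (A ⊗ LT)) (f' : V ⟶ L' ⊗ LT) (g : LT ⟶ L ⊗ T) (k : U ⟶ L ⊗ L'T)
    (k' : L'T ⟶ L' ⊗ T)
    (h : b ≫ f' ≫ L' ◁ g = k ≫ L ◁ k' ≫ swapHead L L' T)
    (h' : b' ≫ f = A ◁ f' ≫ swapHead A L' LT) :
    (A ◁ b ≫ b') ≫ f ≫ L' ◁ (A ◁ g ≫ (α_ A L T).inv) =
      (A ◁ k ≫ (α_ A L L'T).inv) ≫ (A ⊗ L) ◁ k' ≫ swapHead (A ⊗ L) L' T := by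
  have h'' := congrArg (fun f => A ◁ f) h
  simp only [whiskerLeft_comp] at h''
  rw [Category.assoc, reassoc_of% h', whiskerLeft_comp, ← reassoc_of% swapHead_naturality_right,
    reassoc_of% h'', swapHead_tensor_left]
  simp

/-- Moving an entry past a block. -/
lemma Rearr.exists_cons_swap (X : ι → M) (a : ι) (l m : List ι) :
    ∃ w : Rearr (a :: (l ++ m)) (l ++ (a :: m)), w.braid X ≫ (tensAppend X l (a :: m)).hom =
      X a ◁ (tensAppend X l m).hom ≫ swapHead (X a) (tens X l) (tens X m) := by
  induction l with
  | nil =>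
    obtain ⟨w, h⟩ := Rearr.exists_refl X (a :: m)
    refine ⟨w, ?_⟩
    simp only [List.nil_append]
    rw [h]
    simp only [tensAppend, tens, Iso.symm_hom, swapHead_unit_right]
    rw [← whiskerLeft_comp_assoc, Iso.inv_hom_id]
    simp
  | cons b l ih =>
    obtain ⟨w, h⟩ := ih
    refine ⟨.trans (.swap a b (l ++ m)) (.cons b w), ?_⟩
    exact swapHead_cons_aux (w.braid X) (tensAppend X l (a :: m)).hom (tensAppend X l m).hom h

/-- Exchanging two blocks. -/
lemma Rearr.exists_append_swap (X : ι → M) (l l' m : List ι) :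
    ∃ w : Rearr (l ++ (l' ++ m)) (l' ++ (l ++ m)),
      w.braid X ≫ (tensAppend X l' (l ++ m)).hom ≫ tens X l' ◁ (tensAppend X l m).hom =
        (tensAppend X l (l' ++ m)).hom ≫ tens X l ◁ (tensAppend X l' m).hom ≫
          swapHead (tens X l) (tens X l') (tens X m) := by
  induction l with
  | nil =>
    obtain ⟨w, h⟩ := Rearr.exists_refl X (l' ++ m)
    refine ⟨w, ?_⟩
    simp only [List.nil_append]
    rw [h]
    change 𝟙 _ ≫ (tensAppend X l' m).hom ≫ tens X l' ◁ (λ_ (tens X m)).inv =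
      (λ_ (tens X (l' ++ m))).inv ≫ 𝟙_ M ◁ (tensAppend X l' m).hom ≫
        swapHead (𝟙_ M) (tens X l') (tens X m)
    rw [swapHead_unit_left, leftUnitor_naturality_assoc, Iso.inv_hom_id_assoc, Category.id_comp]
  | cons a l ih =>
    obtain ⟨w, h⟩ := ih
    obtain ⟨w', h'⟩ := Rearr.exists_cons_swap X a l' (l ++ m)
    refine ⟨.trans (.cons a w) w', ?_⟩
    exact swapHead_append_aux (w.braid X) (w'.braid X) (tensAppend X l' (a :: (l ++ m))).hom
      _ (tensAppend X l m).hom _ _ h h'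

end Words

end Blocks

/-! ### Lists of pairs and block permutations -/

section Lexicographic

variable {M : Type u} [Category.{v} M] [MonoidalCategory M]
variable {ι : Type} {κ : ι → Type}

/-- The concatenation of lists, as a list of pairs. -/
def lexLists (L : ∀ i, List (κ i)) : List ι → List (Σ i, κ i)
  | [] => []
  | i :: l => (L i).map (Sigma.mk i) ++ lexLists L l

/-- Rebracketing of a tensor product of blocks. -/
def tensLexLists (L : ∀ i, List (κ i)) (Y : (Σ i, κ i) → M) :
    ∀ l : List ι, tens Y (lexLists L l) ⟶ tens (fun i => tens (fun j => Y ⟨i, j⟩) (L i)) l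
  | [] => 𝟙 (𝟙_ M)
  | i :: l => (tensAppend Y _ _).hom ≫
      ((tensReindex (Sigma.mk i) Y (L i)).hom ⊗ₘ tensLexLists L Y l)

/-- Generalized associativity: a product over a concatenation of blocks is the product of the
products over the blocks. -/
lemma tensProd_lexLists {N : M} [MonObj N] (L : ∀ i, List (κ i)) {Y : (Σ i, κ i) → M}
    (φ : ∀ x, Y x ⟶ N) (l : List ι) :
    tensProd φ (lexLists L l) =
      tensLexLists L Y l ≫ tensProd (fun i => tensProd (fun j => φ ⟨i, j⟩) (L i)) l := by
  induction l with
  | nil => exact (Category.id_comp _).symm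
  | cons i l ih =>
    simp only [lexLists, tensLexLists, tens, tensProd]
    rw [tensProd_append, tensProd_map, ih, Category.assoc, tensorHom_comp_tensorHom_assoc]

lemma tensorHom_comp_comp_aux {U A B A' B' A'' B'' S T : M} (w : U ⟶ S) (e : S ⟶ A' ⊗ B')
    (e' : U ⟶ A ⊗ B) (f : A ⟶ A') (g : B ⟶ B') (r : A' ⟶ A'') (r' : A ⟶ T) (f' : T ⟶ A'')
    (t : B' ⟶ B'') {T' : M} (t' : B ⟶ T') (g' : T' ⟶ B'') (h : w ≫ e = e' ≫ (f ⊗ₘ g))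
    (hr : f ≫ r = r' ≫ f') (ht : g ≫ t = t' ≫ g') :
    w ≫ e ≫ (r ⊗ₘ t) = (e' ≫ (r' ⊗ₘ t')) ≫ (f' ⊗ₘ g') := by
  rw [reassoc_of% h, tensorHom_comp_tensorHom, hr, ht, Category.assoc, tensorHom_comp_tensorHom]

variable [SymmetricCategory M]

lemma Rearr.exists_append (X : ι → M) {l l' m m' : List ι} (w : Rearr l l') (w' : Rearr m m') :
    ∃ w'' : Rearr (l ++ m) (l' ++ m'), w''.braid X ≫ (tensAppend X l' m').hom =
      (tensAppend X l m).hom ≫ (w.braid X ⊗ₘ w'.braid X) := by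
  obtain ⟨w₁, h₁⟩ := w.exists_append_right X m
  obtain ⟨w₂, h₂⟩ := w'.exists_append_left X l'
  refine ⟨.trans w₁ w₂, ?_⟩
  rw [Rearr.braid, Category.assoc, h₂, reassoc_of% h₁, MonoidalCategory.tensorHom_def]

lemma swapHead_blocks_aux {U V W W' A B T A' B' T' : M} (w : U ⟶ V) (a : V ⟶ B ⊗ W)
    (b : W ⟶ A ⊗ T) (a' : U ⟶ A ⊗ W') (b' : W' ⟶ B ⊗ T) (r : A ⟶ A') (s : B ⟶ B') (t : T ⟶ T')
    (h : w ≫ a ≫ B ◁ b = a' ≫ A ◁ b' ≫ swapHead A B T) :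
    w ≫ a ≫ (s ⊗ₘ (b ≫ (r ⊗ₘ t))) =
      (a' ≫ (r ⊗ₘ (b' ≫ (s ⊗ₘ t)))) ≫ swapHead A' B' T' := by
  have e₁ : s ⊗ₘ (b ≫ (r ⊗ₘ t)) = B ◁ b ≫ (s ⊗ₘ (r ⊗ₘ t)) := by
    rw [← id_tensorHom, tensorHom_comp_tensorHom, Category.id_comp]
  have e₂ : r ⊗ₘ (b' ≫ (s ⊗ₘ t)) = A ◁ b' ≫ (r ⊗ₘ (s ⊗ₘ t)) := by
    rw [← id_tensorHom, tensorHom_comp_tensorHom, Category.id_comp]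
  rw [e₁, e₂, reassoc_of% h, ← swapHead_naturality, Category.assoc, Category.assoc]

/-- Rearrangement of the entries of each block. -/
lemma Rearr.exists_lex_inner {m : ℕ} {k : Fin m → ℕ} (Y : (Σ i, Fin (k i)) → M)
    {L : ∀ i, List (Fin (k i))} (w : ∀ i, Rearr (List.finRange (k i)) (L i)) (l : List (Fin m)) :
    ∃ W : Rearr (lexList k l) (lexLists L l), W.braid Y ≫ tensLexLists L Y l =
      (tensLex Y l).hom ≫ tensMap (fun i => (w i).braid fun j => Y ⟨i, j⟩) l := by
  induction l with
  | nil => exact ⟨.nil, rfl⟩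
  | cons i l ih =>
    obtain ⟨W, h⟩ := ih
    obtain ⟨W', h'⟩ := Rearr.exists_append Y ((w i).map (Sigma.mk i)) W
    refine ⟨W', ?_⟩
    exact tensorHom_comp_comp_aux _ _ _ _ _ _ _ _ _ _ _ h' (Rearr.map_braid Y _ (w i)) h

/-- Rearrangement of the blocks. -/
lemma Rearr.exists_lex_outer (L : ∀ i, List (κ i)) (Y : (Σ i, κ i) → M) {l l' : List ι}
    (w : Rearr l l') :
    ∃ W : Rearr (lexLists L l) (lexLists L l'), W.braid Y ≫ tensLexLists L Y l' =
      tensLexLists L Y l ≫ w.braid fun i => tens (fun j => Y ⟨i, j⟩) (L i) := by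
  induction w with
  | nil => exact ⟨.nil, rfl⟩
  | cons i w ih =>
    obtain ⟨W, h⟩ := ih
    obtain ⟨W', h'⟩ := W.exists_append_left Y ((L i).map (Sigma.mk i))
    refine ⟨W', ?_⟩
    simp only [lexLists, tensLexLists, tens, Rearr.braid]
    rw [reassoc_of% h', ← id_tensorHom, tensorHom_comp_tensorHom, Category.id_comp, h,
      Category.assoc, ← id_tensorHom, tensorHom_comp_tensorHom, Category.comp_id]
  | swap i j l =>
    obtain ⟨W, h⟩ := Rearr.exists_append_swap Y ((L i).map (Sigma.mk i)) ((L j).map (Sigma.mk j))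
      (lexLists L l)
    refine ⟨W, ?_⟩
    exact swapHead_blocks_aux _ _ _ _ _ _ _ _ h
  | trans w₁ w₂ ih₁ ih₂ =>
    obtain ⟨W₁, h₁⟩ := ih₁
    obtain ⟨W₂, h₂⟩ := ih₂
    refine ⟨.trans W₁ W₂, ?_⟩
    simp only [Rearr.braid, Category.assoc]
    rw [h₂, reassoc_of% h₁]

lemma mem_lexLists (L : ∀ i, List (κ i)) (x : Σ i, κ i) (l : List ι) :
    x ∈ lexLists L l ↔ x.1 ∈ l ∧ x.2 ∈ L x.1 := by
  induction l with
  | nil => simp [lexLists]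
  | cons i l ih =>
    obtain ⟨i', j⟩ := x
    simp only [lexLists, List.mem_append, ih, List.mem_map, List.mem_cons]
    constructor
    · rintro (⟨j', h, e⟩ | h)
      · cases e
        exact ⟨Or.inl rfl, h⟩
      · exact ⟨Or.inr h.1, h.2⟩
    · rintro ⟨rfl | h, h'⟩
      · exact Or.inl ⟨j, h', rfl⟩
      · exact Or.inr ⟨h, h'⟩

/-- The inverse of a block permutation lists the blocks, and the entries of each block, in their
new order. -/
lemma map_blockPerm_symm {m : ℕ} (σ : Equiv.Perm (Fin m)) {k : Fin m → ℕ}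
    (τ : ∀ i, Equiv.Perm (Fin (k i))) :
    ((List.finRange (∑ i, k i)).map (PreOp.blockPerm σ τ).symm).map finSigmaFinEquiv.symm =
      lexLists (fun i => (List.finRange (k i)).map (τ i).symm)
        ((List.finRange m).map σ.symm) := by
  let L : ∀ i, List (Fin (k i)) := fun i => (List.finRange (k i)).map (τ i).symm
  -- The block permutation is increasing along the reordered pairs. An increasing list containing
  -- every element is `List.finRange`, so the listing is determined.
  have hp : ∀ l : List (Fin m), l.Pairwise (fun i j => σ i < σ j) →
      ((lexLists L l).map fun x => PreOp.blockPerm σ τ (finSigmaFinEquiv x)).Pairwise (· < ·) := by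
    intro l hl
    induction l with
    | nil => simp [lexLists]
    | cons i l ih =>
      rw [List.pairwise_cons] at hl
      rw [lexLists, List.map_append, List.pairwise_append]
      refine ⟨?_, ih hl.2, ?_⟩
      · rw [List.map_map, List.map_map, List.pairwise_map]
        refine (List.sortedLT_finRange (k i)).pairwise.imp ?_
        intro a b hab
        change PreOp.blockPerm σ τ (finSigmaFinEquiv ⟨i, (τ i).symm a⟩) <
          PreOp.blockPerm σ τ (finSigmaFinEquiv ⟨i, (τ i).symm b⟩)
        rw [PreOp.blockPerm_lt, Equiv.symm_apply_apply, Equiv.symm_apply_apply]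
        simpa using hab
      · intro x hx y hy
        simp only [List.mem_map] at hx hy
        obtain ⟨_, ⟨a, ha, rfl⟩, rfl⟩ := hx
        obtain ⟨w, hw, rfl⟩ := hy
        rw [mem_lexLists] at hw
        rw [PreOp.blockPerm_lt]
        simpa using Or.inl (hl.1 _ hw.1)
  have h : List.finRange (∑ i, k i) = (lexLists L ((List.finRange m).map σ.symm)).map
      fun x => PreOp.blockPerm σ τ (finSigmaFinEquiv x) := by
    refine (List.sortedLT_finRange _).eq_of_mem_iff (hp _ ?_).sortedLT ?_
    · rw [List.pairwise_map]
      simpa using (List.sortedLT_finRange m).pairwise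
    · intro x
      simp only [List.mem_finRange, List.mem_map, mem_lexLists, true_iff]
      refine ⟨finSigmaFinEquiv.symm ((PreOp.blockPerm σ τ).symm x), ⟨?_, ?_⟩, ?_⟩
      · exact ⟨σ _, trivial, σ.symm_apply_apply _⟩
      · exact List.mem_map.mpr ⟨τ _ _, List.mem_finRange _, (τ _).symm_apply_apply _⟩
      · simp
  rw [h, List.map_map, List.map_map]
  refine (List.map_congr_left (g := id) fun x _ => ?_).trans (List.map_id _)
  simp

end Lexicographic

/-! ### The algebra of a diagram of monoids with commuting orthogonal pairs -/

section CompAux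

variable {M : Type u} [Category.{v} M]

lemma comp_comp_aux {U V W W' V' N : M} (w : U ⟶ V) (w' : V ⟶ W) (r : W ⟶ W') (r' : V ⟶ V')
    (v : V' ⟶ W') (z : W' ⟶ N) (h : w' ≫ r = r' ≫ v) :
    (w ≫ r') ≫ v ≫ z = (w ≫ w') ≫ r ≫ z := by
  rw [Category.assoc, Category.assoc, reassoc_of% h]

/-- The diagram chase behind `PreOp.eval_comp`: `h₀` is coherence, `h₂` and `h₃` treat rearrangement
inside and of the blocks, `h₄` is naturality, `h₁` and `h₅` split the evaluations, and `h₆` is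
associativity. -/
lemma eval_comp_aux {A B B' C₁ C₂ Z Z' Q Q' T T' N : M} (R : B ≅ A) (w : A ⟶ C₁)
    (z : C₁ ⟶ N) (e : B ⟶ B') (lex : B' ⟶ Z) (v : Z ⟶ Z') (φ : Z' ⟶ Q) (x : Q ⟶ T) (ψ : T ⟶ N)
    (W₁ : B' ⟶ C₂) (W₂ : C₂ ⟶ T') (p : T' ⟶ N) (b : Z' ⟶ Q') (φ' : Q' ⟶ T) (u : T' ⟶ Q')
    (q : Q' ⟶ N) {u' : C₂ ⟶ Z'} {E : Z ⟶ Q}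
    (h₀ : R.hom ≫ w ≫ z = e ≫ (W₁ ≫ W₂) ≫ p) (h₁ : E = v ≫ φ) (h₂ : W₁ ≫ u' = lex ≫ v)
    (h₃ : W₂ ≫ u = u' ≫ b) (h₄ : b ≫ φ' = φ ≫ x) (h₅ : φ' ≫ ψ = q) (h₆ : p = u ≫ q) :
    w ≫ z = (R.inv ≫ e ≫ lex) ≫ E ≫ x ≫ ψ := by
  rw [← cancel_epi R.hom, h₀, h₁, h₆, ← h₅]
  simp only [Category.assoc, Iso.hom_inv_id_assoc]
  rw [← reassoc_of% h₄, ← reassoc_of% h₂, reassoc_of% h₃]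

end CompAux

section OfDiagram

local notation "η" => MonObj.one
local notation "μ" => MonObj.mul

variable {M : Type u} [Category.{v} M] [MonoidalCategory M] [SymmetricCategory M]

lemma braid_tensProd_congr {ι : Type} {X : ι → M} {N : M} [MonObj N] (φ : ∀ i, X i ⟶ N)
    {l₁ l₂ l₁' l₂' : List ι} (hl : l₁.Nodup) (w : Rearr l₁ l₂) (w' : Rearr l₁' l₂') (h₁ : l₁ = l₁')
    (h₂ : l₂ = l₂') :
    w.braid X ≫ tensProd φ l₂ = eqToHom (congrArg (tens X) h₁) ≫ w'.braid X ≫ tensProd φ l₂' := by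
  subst h₁ h₂
  rw [eqToHom_refl, Category.id_comp, Rearr.braid_eq X hl w w']

/-- If two adjacent factors commute in `N`, braiding them leaves the product unchanged; this is
where orthogonality enters the evaluation. -/
lemma exists_swap_tensProd {ι : Type} {X : ι → M} {N : M} [MonObj N] (φ : ∀ i, X i ⟶ N) {i j : ι}
    (h : Commuting (φ i) (φ j)) (l l' : List ι) :
    ∃ w : Rearr (l ++ (i :: j :: l')) (l ++ (j :: i :: l')),
      w.braid X ≫ tensProd φ (l ++ (j :: i :: l')) = tensProd φ (l ++ (i :: j :: l')) := by
  induction l with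
  | nil =>
    refine ⟨.swap i j l', ?_⟩
    unfold Commuting at h
    simp only [List.nil_append, Rearr.braid_swap, tensProd, tens]
    rw [hom_mul_assoc, hom_mul_assoc, h, swapHead]
    simp only [Category.assoc, Iso.hom_inv_id_assoc]
    rw [← tensorHom_id, tensorHom_comp_tensorHom_assoc, Category.id_comp]
  | cons a l ih =>
    obtain ⟨w, h⟩ := ih
    refine ⟨.cons a w, ?_⟩
    simp only [List.cons_append, Rearr.braid, tensProd, tens]
    rw [← id_tensorHom, tensorHom_comp_tensorHom_assoc, Category.id_comp, h]

variable {C : Type v} [SmallCategory C] (F : C ⥤ Mon M)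

lemma perm_map_finRange {n : ℕ} (σ : Equiv.Perm (Fin n)) :
    (List.finRange n).Perm ((List.finRange n).map σ) :=
  (Equiv.Perm.map_finRange_perm σ).symm

/-- The value of an operation `(σ, f)` on a diagram of monoids: the product of the factors, in the
order prescribed by `σ⁻¹`. -/
noncomputable def PreOp.eval {n : ℕ} {c : Fin n → C} {t : C} (o : PreOp c t) :
    tensFin (fun i => (F.obj (c i)).X) ⟶ (F.obj t).X :=
  (Rearr.nonempty_of_perm (perm_map_finRange o.perm.symm)).some.braid
      (fun i => (F.obj (c i)).X) ≫
    tensProd (fun i => (F.map (o.hom i)).hom) ((List.finRange n).map o.perm.symm)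

variable {F}

/-- `PreOp.eval` chooses a rearrangement arbitrarily. By coherence any other one may be used, in
particular one adapted to the computation at hand. -/
lemma PreOp.eval_eq {n : ℕ} {c : Fin n → C} {t : C} (o : PreOp c t) {l : List (Fin n)}
    (h : (List.finRange n).map o.perm.symm = l) (w : Rearr (List.finRange n) l) :
    o.eval F = w.braid (fun i => (F.obj (c i)).X) ≫
      tensProd (fun i => (F.map (o.hom i)).hom) l := by
  subst h
  exact congrArg (· ≫ _) (Rearr.braid_eq _ (List.nodup_finRange n) _ w)

lemma map_swap_finRange {n : ℕ} {p q : Fin n} (h : p.val + 1 = q.val) :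
    ∃ l l' : List (Fin n), List.finRange n = l ++ (p :: q :: l') ∧
      (List.finRange n).map (Equiv.swap p q) = l ++ (q :: p :: l') := by
  have hp : p.val < (List.finRange n).length := by simp
  have hq : p.val + 1 < (List.finRange n).length := by simp [h]
  have e : List.finRange n = (List.finRange n).take p.val ++
      (p :: q :: (List.finRange n).drop (p.val + 1 + 1)) := by
    conv_lhs => rw [← List.take_append_drop p.val (List.finRange n), List.drop_eq_getElem_cons hp,
      List.drop_eq_getElem_cons hq]
    simp [h]
  have hn := List.nodup_finRange n
  refine ⟨_, _, e, ?_⟩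
  conv_lhs => rw [e]
  rw [e] at hn
  have hm : ∀ l : List (Fin n), p ∉ l → q ∉ l → l.map (Equiv.swap p q) = l := by
    intro l h₁ h₂
    refine (List.map_congr_left fun x hx => ?_).trans (List.map_id _)
    exact Equiv.swap_apply_of_ne_of_ne (fun e => h₁ (e ▸ hx)) fun e => h₂ (e ▸ hx)
  simp only [List.nodup_append, List.nodup_cons, List.mem_cons] at hn
  rw [List.map_append, List.map_cons, List.map_cons, Equiv.swap_apply_left,
    Equiv.swap_apply_right, hm _ ?_ ?_, hm _ ?_ ?_]
  all_goals grind

/-- The two orderings `σ⁻¹` and `σ'⁻¹` differ by exchanging two neighbours, whose images commute by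
`hF`. -/
lemma PreOp.eval_step {perp : OrthRel C} (hF : PerpCommuting perp F) {n : ℕ} {c : Fin n → C} {t : C}
    {o o' : PreOp c t} (h : Step perp o o') : o.eval F = o'.eval F := by
  obtain ⟨σ, f⟩ := o
  obtain ⟨σ', f'⟩ := o'
  obtain ⟨rfl, p, q, hpq, hr, hσ⟩ := h
  obtain ⟨l, l', e, e'⟩ := map_swap_finRange hpq
  dsimp only at hr hσ
  have h₁ : (List.finRange n).map σ.symm =
      l.map σ.symm ++ (σ.symm p :: σ.symm q :: l'.map σ.symm) := by
    rw [e]; simp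
  have h₂ : (List.finRange n).map σ'.symm =
      l.map σ.symm ++ (σ.symm q :: σ.symm p :: l'.map σ.symm) := by
    rw [hσ, Equiv.Perm.coe_mul, ← List.map_map, e']
    simp
  obtain ⟨w, hw⟩ := exists_swap_tensProd (fun i => (F.map (f i)).hom) (hF _ _ hr)
    (l.map σ.symm) (l'.map σ.symm)
  obtain ⟨w₀⟩ := Rearr.nonempty_of_perm (h₁ ▸ perm_map_finRange σ.symm)
  rw [PreOp.eval_eq _ h₁ w₀, PreOp.eval_eq _ h₂ (w₀.trans w), Rearr.braid, Category.assoc, hw]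

lemma PreOp.eval_sim {perp : OrthRel C} (hF : PerpCommuting perp F) {n : ℕ} {c : Fin n → C} {t : C}
    {o o' : PreOp c t} (h : Sim perp o o') : o.eval F = o'.eval F := by
  induction h with
  | refl => rfl
  | tail _ h ih => exact ih.trans (eval_step hF h)

lemma PreOp.eval_permute {n : ℕ} {c : Fin n → C} {t : C} (o : PreOp c t) (σ : Equiv.Perm (Fin n))
    (w : Rearr (List.finRange n) ((List.finRange n).map σ)) :
    braidPerm (fun i => (F.obj (c i)).X) σ w ≫ (o.permute σ).eval F = o.eval F := by
  obtain ⟨w'⟩ := Rearr.nonempty_of_perm (perm_map_finRange (o.permute σ).perm.symm)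
  -- Since `(o.perm * σ)⁻¹` followed by `σ` is `o.perm⁻¹`, the rearrangement `w` followed by the
  -- `σ`-image of one for the permuted operation computes `o.eval`.
  have h : (List.finRange n).map o.perm.symm =
      ((List.finRange n).map (o.permute σ).perm.symm).map σ := by
    rw [List.map_map]
    refine List.map_congr_left fun x _ => ?_
    exact (σ.apply_symm_apply _).symm
  rw [o.eval_eq h (w.trans (w'.map σ)), (o.permute σ).eval_eq rfl w',
    tensProd_map (fun i => (F.map (o.hom i)).hom) σ]
  exact comp_comp_aux _ _ _ _ _ _ (w'.map_braid (fun i => (F.obj (c i)).X) σ)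

lemma PreOp.eval_one (t : C) : (PreOp.one t).eval F = (ρ_ (F.obj t).X).hom := by
  obtain ⟨w, hw⟩ := Rearr.exists_refl (fun _ : Fin 1 => (F.obj t).X) (List.finRange 1)
  rw [PreOp.eval_eq (PreOp.one t) (List.map_id _) w, hw]
  refine (Category.id_comp _).trans ?_
  change ((F.map (𝟙 t)).hom ⊗ₘ η) ≫ μ = (ρ_ (F.obj t).X).hom
  rw [F.map_id]
  exact (MonObj.mul_one_hom (𝟙 _)).trans (Category.comp_id _)

lemma PreOp.eval_comp {m : ℕ} {a : Fin m → C} {t : C} (o : PreOp a t) {k : Fin m → ℕ}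
    {b : ∀ i, Fin (k i) → C} (p : ∀ i, PreOp (b i) (a i)) :
    (o.comp p).eval F =
      (tensConcat fun x : Σ i, Fin (k i) => (F.obj (b x.1 x.2)).X).hom ≫
        tensFinMap (fun i => (p i).eval F) ≫ o.eval F := by
  let Y : (Σ i, Fin (k i)) → M := fun x => (F.obj (b x.1 x.2)).X
  let Φ : ∀ x, Y x ⟶ (F.obj t).X := fun x => (F.map ((p x.1).hom x.2 ≫ o.hom x.1)).hom
  let L : ∀ i, List (Fin (k i)) := fun i => (List.finRange (k i)).map (p i).perm.symm
  let l := (List.finRange m).map o.perm.symm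
  obtain ⟨w₀⟩ := Rearr.nonempty_of_perm (perm_map_finRange (o.comp p).perm.symm)
  obtain ⟨w⟩ := Rearr.nonempty_of_perm (perm_map_finRange o.perm.symm)
  have hv := fun i => Rearr.nonempty_of_perm (perm_map_finRange (p i).perm.symm)
  let v := fun i => (hv i).some
  obtain ⟨W₁, h₁⟩ := Rearr.exists_lex_inner Y v (List.finRange m)
  obtain ⟨W₂, h₂⟩ := Rearr.exists_lex_outer L Y w
  -- Once positions are identified with pairs, the composite permutation and "inside the blocks,
  -- then of the blocks" are rearrangements with the same ends, so coherence identifies them.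
  have e := braid_tensProd_congr Φ ((List.nodup_finRange _).map finSigmaFinEquiv.symm.injective)
    (w₀.map finSigmaFinEquiv.symm) (W₁.trans W₂) (map_finRange_eq_lexList k)
    (map_blockPerm_symm o.perm fun i => (p i).perm)
  have e' := w₀.map_braid Y finSigmaFinEquiv.symm
  rw [tensProd_map, reassoc_of% e'] at e
  rw [(o.comp p).eval_eq rfl w₀, o.eval_eq rfl w]
  have e₁ : tensFinMap (fun i => (p i).eval F) =
      tensFinMap (fun i => (v i).braid fun j => Y ⟨i, j⟩) ≫
        tensFinMap fun i => tensProd (fun j => (F.map ((p i).hom j)).hom) (L i) := by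
    rw [← tensFinMap_comp]
    rfl
  have e₂ := tensMap_tensProd
    (fun i => tensProd (fun j => (F.map ((p i).hom j)).hom) (L i))
    (fun i => (F.map (o.hom i)).hom) l
  have e₃ : (fun i => tensProd (fun j => (F.map ((p i).hom j)).hom) (L i) ≫
      (F.map (o.hom i)).hom) = fun i => tensProd (fun j => Φ ⟨i, j⟩) (L i) := by
    funext i
    rw [tensProd_comp]
    simp only [Φ, F.map_comp, Mon.comp_hom']
  rw [e₃] at e₂
  exact eval_comp_aux _ _ _ _ _ _ _ _ _ _ _ _ _ _ _ _ e e₁ h₁ h₂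
    (Rearr.braid_naturality _ w) e₂ (tensProd_lexLists L Φ l)

/-- The algebra of a diagram of monoids with commuting orthogonal pairs. -/
noncomputable def algOfDiagram {perp : OrthRel C} (hF : PerpCommuting perp F) : Alg M perp where
  obj t := (F.obj t).X
  act := Quotient.lift (fun o => o.eval F) fun _ _ h => PreOp.eval_sim hF h
  act_permute q σ w := by
    obtain ⟨o, rfl⟩ := Op.exists_rep q
    exact o.eval_permute σ w
  act_one t := PreOp.eval_one t
  act_comp {m a t} q {k b} p := by
    obtain ⟨o, rfl⟩ := Op.exists_rep q
    choose p' hp' using fun i => Op.exists_rep (p i)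
    obtain rfl : (fun i => Op.mk perp (p' i)) = p := funext hp'
    rw [Op.comp_mk]
    exact o.eval_comp p'

end OfDiagram

/-! ### Reindexing and concatenation of tensor products -/

section Reindexing

variable {M : Type u} [Category.{v} M] [MonoidalCategory M]
variable {ι κ : Type}

lemma tens_congr {X : ι → M} {Y : κ → M} :
    ∀ {l : List ι} {l' : List κ}, l.map X = l'.map Y → tens X l = tens Y l'
  | [], [], _ => rfl
  | i :: l, j :: l', h => by
    rw [List.map_cons, List.map_cons, List.cons.injEq] at h
    simp only [tens]
    rw [h.1, tens_congr h.2]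

/-- The identification of two tensor products with the same factors. -/
def tensCast {X : ι → M} {Y : κ → M} {l : List ι} {l' : List κ} (h : l.map X = l'.map Y) :
    tens X l ⟶ tens Y l' :=
  eqToHom (tens_congr h)

lemma tensorHom_eqToHom {A A' B B' : M} (h : A = A') (h' : B = B') :
    eqToHom h ⊗ₘ eqToHom h' = eqToHom (by rw [h, h']) := by
  subst h h'
  exact id_tensorHom_id _ _

/-- Reindexing leaves every factor in place, so it is a transport along an equality of objects; the
bookkeeping below then reduces to composing such transports. -/
lemma tensReindex_hom (g : κ → ι) (X : ι → M) (l : List κ) :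
    (tensReindex g X l).hom = tensCast (by rw [List.map_map]; rfl) := by
  induction l with
  | nil => rfl
  | cons j l ih =>
    change X (g j) ◁ (tensReindex g X l).hom = _
    rw [ih, ← id_tensorHom]
    exact tensorHom_eqToHom rfl _

lemma tensReindex_inv (g : κ → ι) (X : ι → M) (l : List κ) :
    (tensReindex g X l).inv = tensCast (by rw [List.map_map]; rfl) := by
  rw [← cancel_epi (tensReindex g X l).hom, Iso.hom_inv_id, tensReindex_hom, tensCast, tensCast,
    eqToHom_trans, eqToHom_refl]

lemma tensCast_cons {X : ι → M} {Y : κ → M} {i : ι} {l : List ι} {j : κ} {l' : List κ}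
    (h : (i :: l).map X = (j :: l').map Y) (h₁ : X i = Y j) (h₂ : l.map X = l'.map Y) :
    tensCast h = eqToHom h₁ ⊗ₘ tensCast h₂ :=
  (tensorHom_eqToHom _ _).symm

lemma tensAppend_nil_aux {A T S : M} (a : S ⟶ T ⊗ 𝟙_ M) (c : S ⟶ T)
    (h : a = c ≫ (ρ_ T).inv) :
    A ◁ a ≫ (α_ A T (𝟙_ M)).inv = (𝟙 A ⊗ₘ c) ≫ (ρ_ (A ⊗ T)).inv := by
  rw [h, id_tensorHom, rightUnitor_tensor_inv, whiskerLeft_comp, Category.assoc]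

lemma tensAppend_nil (X : ι → M) (l : List ι) :
    (tensAppend X l []).hom = tensCast (by rw [List.append_nil]) ≫ (ρ_ (tens X l)).inv := by
  induction l with
  | nil =>
    refine Eq.trans ?_ (Category.id_comp _).symm
    exact unitors_inv_equal
  | cons i l ih =>
    have e : List.map X ((i :: l) ++ []) = List.map X (i :: l) := by rw [List.append_nil]
    refine Eq.trans ?_ (congrArg (· ≫ _) (tensCast_cons e rfl (congrArg (List.map X) (List.append_nil l))).symm)
    exact tensAppend_nil_aux _ _ ih

lemma tensCast_append_aux {A A' B B' C C' S S' : M} (e : A ⟶ A') (c : S ⟶ S') (a : S ⟶ B ⊗ C)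
    (a' : S' ⟶ B' ⊗ C') (f : B ⟶ B') (g : C ⟶ C') (h : c ≫ a' = a ≫ (f ⊗ₘ g)) :
    (e ⊗ₘ c) ≫ A' ◁ a' ≫ (α_ A' B' C').inv =
      (A ◁ a ≫ (α_ A B C).inv) ≫ ((e ⊗ₘ f) ⊗ₘ g) := by
  rw [Category.assoc, ← associator_inv_naturality, ← id_tensorHom, ← id_tensorHom,
    tensorHom_comp_tensorHom_assoc, tensorHom_comp_tensorHom_assoc, h, Category.comp_id,
    Category.id_comp]

lemma tensCast_tensAppend {X : ι → M} {Y : κ → M} {m : List ι} {m' : List κ}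
    (h' : m.map X = m'.map Y) : ∀ {l : List ι} {l' : List κ} (h : l.map X = l'.map Y),
    tensCast (by rw [List.map_append, List.map_append, h, h']) ≫ (tensAppend Y l' m').hom =
      (tensAppend X l m).hom ≫ (tensCast h ⊗ₘ tensCast h')
  | [], [], h => by
    refine (leftUnitor_inv_naturality _).trans ?_
    exact congrArg (_ ≫ ·) (id_tensorHom _ _).symm
  | i :: l, j :: l', h => by
    have h₁ := h
    rw [List.map_cons, List.map_cons, List.cons.injEq] at h₁
    have e : ((i :: l) ++ m).map X = ((j :: l') ++ m').map Y := by
      rw [List.map_append, List.map_append, h, h']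
    have e' : (l ++ m).map X = (l' ++ m').map Y := by
      rw [List.map_append, List.map_append, h₁.2, h']
    rw [tensCast_cons h h₁.1 h₁.2]
    refine (congrArg (· ≫ _) (tensCast_cons e h₁.1 e')).trans ?_
    exact tensCast_append_aux _ _ _ _ _ _ (tensCast_tensAppend h' h₁.2)

/-- The concatenation of lists. -/
def flatLists (L : κ → List ι) : List κ → List ι
  | [] => []
  | i :: l => L i ++ flatLists L l

/-- Rebracketing of the tensor product over a concatenation of lists. -/
def tensFlat (X : ι → M) (L : κ → List ι) :
    ∀ l : List κ, tens X (flatLists L l) ⟶ tens (fun i => tens X (L i)) l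
  | [] => 𝟙 (𝟙_ M)
  | i :: l => (tensAppend X _ _).hom ≫ (𝟙 (tens X (L i)) ⊗ₘ tensFlat X L l)

/-- The position in a list of lists, as a pair. -/
abbrev entry {m : ℕ} (L : Fin m → List ι) (x : Σ i, Fin (L i).length) : ι := (L x.1).get x.2

lemma map_get_finRange (l : List ι) : (List.finRange l.length).map l.get = l := by
  simp

lemma map_eq_map_get {α : Type*} (X : ι → α) (l : List ι) :
    l.map X = (List.finRange l.length).map fun j => X (l.get j) := by
  conv_lhs => rw [← map_get_finRange l, List.map_map]
  rfl

lemma map_entry {m : ℕ} (L : Fin m → List ι) (l : List (Fin m)) :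
    (lexList (fun i => (L i).length) l).map (entry L) = flatLists L l := by
  induction l with
  | nil => rfl
  | cons i l ih =>
    rw [lexList, flatLists, List.map_append, ih, List.map_map]
    exact congrArg (· ++ _) (map_get_finRange (L i))

/-- Blocks given by arbitrary lists are compared with blocks indexed by `Fin`, the form in which the
associativity axiom of an algebra is available. -/
lemma tensCast_tensLex {m : ℕ} (X : ι → M) (L : Fin m → List ι) (l : List (Fin m)) :
    tensCast (by rw [← map_entry, List.map_map]; rfl) ≫
        (tensLex (fun x : Σ i, Fin (L i).length => X (entry L x)) l).hom =
      tensFlat X L l ≫ tensMap (fun i => tensCast (X := X) (l := L i)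
        (Y := fun j => X ((L i).get j)) (l' := List.finRange _)
        (map_eq_map_get X (L i))) l := by
  induction l with
  | nil => exact (Category.id_comp (𝟙 (𝟙_ M))).trans (Category.id_comp _).symm
  | cons i l ih =>
    have h : (L i).map X = ((List.finRange (L i).length).map (Sigma.mk i)).map
        fun x => X (entry L x) := by
      rw [List.map_map]
      exact map_eq_map_get X (L i)
    have h' : (flatLists L l).map X = (lexList (fun i => (L i).length) l).map
        fun x => X (entry L x) := by
      rw [← map_entry, List.map_map]
      rfl
    refine tensorHom_comp_comp_aux _ _ _ _ _ _ _ _ _ _ _ (tensCast_tensAppend h' h) ?_ ih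
    rw [tensReindex_hom]
    exact (eqToHom_trans _ _).trans (Category.id_comp _).symm

end Reindexing

/-- The block permutation built from identities preserves the lexicographic order, so there are no
inversions. -/
lemma PreOp.sim_blockPerm_one {C : Type v} [SmallCategory C] (perp : OrthRel C) {m : ℕ}
    {k : Fin m → ℕ} {b : Fin (∑ i, k i) → C} {t : C} (f : ∀ x, b x ⟶ t) :
    Sim perp (⟨blockPerm 1 fun _ => 1, f⟩ : PreOp b t) ⟨1, f⟩ := by
  refine sim_of_inversions rfl fun i j h h' => ?_
  dsimp only at h h'
  rw [blockPerm_lt] at h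
  have e := finSigma_lt (finSigmaFinEquiv.symm i) (finSigmaFinEquiv.symm j)
  rw [Equiv.apply_symm_apply, Equiv.apply_symm_apply] at e
  exact absurd (e.mpr h) (not_lt.mpr (le_of_lt h'))

lemma eqToHom_comp_aux {M : Type u} [Category.{v} M] {A A' B N : M} (h : A = A') (h' : A' = A)
    (f : A ⟶ B) (g : B ⟶ N) : eqToHom h ≫ (eqToHom h' ≫ f) ≫ g = f ≫ g := by
  subst h
  simp

lemma eqToHom_comp_comp_aux {M : Type u} [Category.{v} M] {A A' A'' B B' K N : M} (h : A = A')
    (h' : A' = A'') (f : A'' ⟶ B) (p : B ⟶ K) (g : K ⟶ N) (f' : A ⟶ B') (r : B' ⟶ B)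
    (e : eqToHom (h.trans h') ≫ f = f' ≫ r) :
    eqToHom h ≫ eqToHom h' ≫ f ≫ p ≫ g = f' ≫ (r ≫ p) ≫ g := by
  rw [eqToHom_trans_assoc, reassoc_of% e, Category.assoc]

lemma tensConcat_hom {M : Type u} [Category.{v} M] [MonoidalCategory M] {m : ℕ} {k : Fin m → ℕ}
    (Y : (Σ i, Fin (k i)) → M) :
    (tensConcat Y).hom = tensCast (by rw [← map_finRange_eq_lexList, List.map_map]; rfl) ≫
      (tensLex Y (List.finRange m)).hom := by
  have h := tensReindex_inv finSigmaFinEquiv.symm Y (List.finRange (∑ i, k i))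
  refine (congrArg (fun z => z ≫ eqToHom (congrArg (tens Y) (map_finRange_eq_lexList k)) ≫
    (tensLex Y (List.finRange m)).hom) h).trans ?_
  exact eqToHom_trans_assoc _ _ _

/-! ### The action of operations with trivial permutation -/

namespace Alg

variable {M : Type u} [Category.{v} M] [MonoidalCategory M] [SymmetricCategory M]
variable {C : Type v} [SmallCategory C] {perp : OrthRel C} (A : Alg M perp)

/-- The action of an operation with trivial permutation. -/
def actId {n : ℕ} {c : Fin n → C} {t : C} (f : ∀ i, c i ⟶ t) :
    tensFin (fun i => A.obj (c i)) ⟶ A.obj t :=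
  A.act (Op.mk perp ⟨1, f⟩)

variable {ι κ : Type} {c : ι → C} {a t : C}

/-- The action of an operation with trivial permutation, with inputs indexed by a list. -/
def actList (f : ∀ i, c i ⟶ t) (l : List ι) : tens (fun i => A.obj (c i)) l ⟶ A.obj t :=
  tensCast (map_eq_map_get (fun i => A.obj (c i)) l) ≫ A.actId fun j => f (l.get j)

/-- Any enumeration of the list may replace `l.get`: its length and its values are forced. -/
lemma actList_eq (f : ∀ i, c i ⟶ t) {n : ℕ} (e : Fin n → ι) {l : List ι}
    (h : (List.finRange n).map e = l) :
    A.actList f l = tensCast (by rw [← h, List.map_map]; rfl) ≫ A.actId fun j => f (e j) := by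
  have hn : n = l.length := by rw [← h]; simp
  subst hn
  have he : e = l.get := by
    have h' := h.trans (map_get_finRange l).symm
    rw [List.map_inj_left] at h'
    exact funext fun i => h' i (List.mem_finRange i)
  subst he
  rfl

lemma actList_map (f : ∀ i, c i ⟶ t) (g : κ → ι) (l : List κ) :
    A.actList f (l.map g) =
      tensCast (by rw [List.map_map]; rfl) ≫ A.actList (fun k => f (g k)) l := by
  rw [A.actList_eq f (fun j => g (l.get j)) (by conv_rhs => rw [map_eq_map_get g l])]
  exact (eqToHom_trans_assoc _ _ _).symm

lemma actList_congr (f : ∀ i, c i ⟶ t) {l l' : List ι} (h : l = l') :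
    A.actList f l = tensCast (by rw [h]) ≫ A.actList f l' := by
  subst h
  exact (Category.id_comp _).symm

lemma act_comp_id {m : ℕ} {k : Fin m → ℕ} {a : Fin m → C} {b : ∀ i, Fin (k i) → C}
    (g : ∀ i, a i ⟶ t) (f : ∀ i j, b i j ⟶ a i) :
    A.actList (c := fun x : Σ i, Fin (k i) => b x.1 x.2) (fun x => f x.1 x.2 ≫ g x.1)
        (lexList k (List.finRange m)) =
      (tensLex (fun x : Σ i, Fin (k i) => A.obj (b x.1 x.2)) (List.finRange m)).hom ≫
        tensFinMap (fun i => A.actId (f i)) ≫ A.actId g := by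
  have h := A.act_comp (Op.mk perp ⟨1, g⟩) fun i => Op.mk perp ⟨1, f i⟩
  rw [Op.comp_mk] at h
  have e : Op.mk perp ((⟨1, g⟩ : PreOp a t).comp fun i => (⟨1, f i⟩ : PreOp (b i) (a i))) =
      Op.mk perp ⟨1, _⟩ := Op.mk_eq_mk.mpr (PreOp.sim_blockPerm_one perp _)
  rw [e] at h
  rw [A.actList_eq _ finSigmaFinEquiv.symm (map_finRange_eq_lexList k)]
  refine (congrArg (_ ≫ ·) h).trans ?_
  rw [tensConcat_hom]
  exact eqToHom_comp_aux _ _ _ _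

/-- The associativity axiom for trivial permutations, with blocks `L i` and the same `g` applied to
each block. The case of one block gives functoriality in `g`, that of two blocks with `g = 𝟙` gives
multiplicativity. -/
lemma actList_flatLists {m : ℕ} (L : Fin m → List ι) (f : ∀ i, c i ⟶ a) (g : a ⟶ t) :
    A.actList (fun x => f x ≫ g) (flatLists L (List.finRange m)) =
      tensFlat (fun i => A.obj (c i)) L (List.finRange m) ≫
        tensMap (fun i => A.actList f (L i)) (List.finRange m) ≫
          A.actId fun _ : Fin m => g := by
  have h := A.act_comp_id (fun _ : Fin m => g) fun i (j : Fin (L i).length) => f ((L i).get j)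
  have h' : tensMap (fun i => tensCast (map_eq_map_get (fun i => A.obj (c i)) (L i)))
      (List.finRange m) ≫ tensFinMap (fun i => A.actId fun j => f ((L i).get j)) =
      tensMap (fun i => A.actList f (L i)) (List.finRange m) :=
    (tensFinMap_comp _ _).symm
  rw [A.actList_congr _ (map_entry L _).symm, A.actList_map]
  refine (congrArg (fun z => _ ≫ _ ≫ z) h).trans ?_
  rw [← h']
  exact eqToHom_comp_comp_aux _ _ _ _ _ _ _ (tensCast_tensLex _ L _)

end Alg

/-! ### The diagram of monoids underlying an algebra -/

section Aux

variable {M : Type u} [Category.{v} M] [MonoidalCategory M]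

lemma append_nil_tensor_aux {S S' A N N' : M} (k : S ⟶ S') (a : S' ⟶ A ⊗ 𝟙_ M) (c : S' ⟶ A)
    (p : A ⟶ N) (z : N ⊗ 𝟙_ M ⟶ N') (ha : a = c ≫ (ρ_ A).inv) {p' : S ⟶ N}
    (hk : k ≫ c ≫ p = p') :
    k ≫ (a ≫ (𝟙 A ⊗ₘ 𝟙 (𝟙_ M))) ≫ (p ⊗ₘ 𝟙 (𝟙_ M)) ≫ z = p' ≫ (ρ_ N).inv ≫ z := by
  rw [id_tensorHom_id, Category.comp_id, ha, ← hk, tensorHom_id, Category.assoc,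
    ← rightUnitor_inv_naturality_assoc, Category.assoc, Category.assoc]

lemma append_append_nil_tensor_aux {S S' A B T N N' : M} (k : S ⟶ S') (a : S' ⟶ A ⊗ T)
    (a' : S ⟶ A ⊗ B) (e : A ⟶ A) (d : B ⟶ T) (b : T ⟶ B ⊗ 𝟙_ M) (c : T ⟶ B) (p : A ⟶ N)
    (q : B ⟶ N) (z : N ⊗ (N ⊗ 𝟙_ M) ⟶ N') (hb : b = c ≫ (ρ_ B).inv)
    (hk : k ≫ a = a' ≫ (e ⊗ₘ d)) (he : e = 𝟙 A) (hd : d ≫ c = 𝟙 B) :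
    k ≫ (a ≫ (𝟙 A ⊗ₘ (b ≫ (𝟙 B ⊗ₘ 𝟙 (𝟙_ M))))) ≫ (p ⊗ₘ (q ⊗ₘ 𝟙 (𝟙_ M))) ≫ z =
      a' ≫ (p ⊗ₘ q) ≫ N ◁ (ρ_ N).inv ≫ z := by
  rw [Category.assoc, reassoc_of% hk, he, id_tensorHom_id, Category.comp_id, hb]
  simp only [tensorHom_comp_tensorHom_assoc, Category.id_comp, Category.assoc, tensorHom_id,
    ← rightUnitor_inv_naturality]
  rw [reassoc_of% hd, ← id_tensorHom, tensorHom_comp_tensorHom_assoc, Category.comp_id]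

lemma cons_tensor_aux {A T N N' P : M} (p : A ⟶ N) (q : T ⟶ N') (z : N ⊗ N' ⟶ P) :
    (A ◁ (λ_ T).inv ≫ (α_ A (𝟙_ M) T).inv) ≫ (((ρ_ A).hom ≫ p) ⊗ₘ q) ≫ z = (p ⊗ₘ q) ≫ z := by
  rw [← Category.id_comp q, ← tensorHom_comp_tensorHom_assoc, tensorHom_id, Category.id_comp]
  simp

lemma one_mul_aux {N : M} (e : 𝟙_ M ⟶ N) (m : N ⊗ N ⟶ N)
    (h : (ρ_ N).hom = (λ_ (N ⊗ 𝟙_ M)).inv ≫ (e ⊗ₘ (ρ_ N).hom) ≫ m) :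
    e ▷ N ≫ m = (λ_ N).hom := by
  rw [tensorHom_def', Category.assoc, ← leftUnitor_inv_naturality_assoc] at h
  have h' := (cancel_epi (ρ_ N).hom).mp (h.symm.trans (Category.comp_id _).symm)
  rw [Iso.inv_comp_eq, Category.comp_id] at h'
  exact h'

/-- The ternary operation `T₃` factors as `1 + 2` and as `2 + 1`; the trailing unit object of `tens`
is removed by cancelling right unitors. -/
lemma mul_assoc_aux {N : M} (m : N ⊗ N ⟶ N) (T₂ : N ⊗ (N ⊗ 𝟙_ M) ⟶ N)
    (T₃ : N ⊗ (N ⊗ (N ⊗ 𝟙_ M)) ⟶ N) (h : T₂ = (𝟙 N ⊗ₘ (ρ_ N).hom) ≫ m)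
    (h' : T₃ = (𝟙 N ⊗ₘ T₂) ≫ m)
    (h'' : T₃ = (N ◁ (N ◁ (λ_ (N ⊗ 𝟙_ M)).inv ≫ (α_ N (𝟙_ M) (N ⊗ 𝟙_ M)).inv) ≫
      (α_ N (N ⊗ 𝟙_ M) (N ⊗ 𝟙_ M)).inv) ≫ (T₂ ⊗ₘ (ρ_ N).hom) ≫ m) :
    m ▷ N ≫ m = (α_ N N N).hom ≫ N ◁ m ≫ m := by
  have e : T₃ = N ◁ N ◁ (ρ_ N).hom ≫ N ◁ m ≫ m := by
    rw [h', h, id_tensorHom, id_tensorHom, whiskerLeft_comp, Category.assoc]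
  have e' : T₃ = N ◁ N ◁ (ρ_ N).hom ≫ (α_ N N N).inv ≫ m ▷ N ≫ m := by
    rw [h'', h, tensorHom_def']
    simp only [id_tensorHom, comp_whiskerRight, Category.assoc]
    monoidal
  rw [e, cancel_epi] at e'
  rw [e', Iso.hom_inv_id_assoc]

lemma mul_map_aux {A B : M} (m : A ⊗ A ⟶ A) (m' : B ⊗ B ⟶ B) (g : A ⟶ B)
    (h : (g ⊗ₘ ((ρ_ A).hom ≫ g)) ≫ m' = ((𝟙 A ⊗ₘ (ρ_ A).hom) ≫ m) ≫ g) :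
    m ≫ g = (g ⊗ₘ g) ≫ m' := by
  rw [← cancel_epi (𝟙 A ⊗ₘ (ρ_ A).hom), ← Category.assoc, ← h, tensorHom_comp_tensorHom_assoc,
    Category.id_comp]

lemma commuting_aux [SymmetricCategory M] {A B N : M} [MonObj N] (p : A ⟶ N) (q : B ⟶ N)
    (h : swapHead A B (𝟙_ M) ≫ (q ⊗ₘ ((p ⊗ₘ MonObj.one) ≫ MonObj.mul)) ≫ MonObj.mul =
      A ◁ B ◁ 𝟙 (𝟙_ M) ≫ (p ⊗ₘ ((q ⊗ₘ MonObj.one) ≫ MonObj.mul)) ≫ MonObj.mul) :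
    Commuting p q := by
  have e : swapHead A B (𝟙_ M) ≫ B ◁ (ρ_ A).hom = A ◁ (ρ_ B).hom ≫ (β_ A B).hom := by
    simp [swapHead]
  have e' : ∀ {A B : M} (p : A ⟶ N) (q : B ⟶ N), p ⊗ₘ ((ρ_ B).hom ≫ q) =
      A ◁ (ρ_ B).hom ≫ (p ⊗ₘ q) := by
    intro A B p q
    rw [← id_tensorHom, tensorHom_comp_tensorHom, Category.id_comp]
  rw [MonObj.mul_one_hom, MonObj.mul_one_hom, e', e', Category.assoc, reassoc_of% e,
    whiskerLeft_id, whiskerLeft_id, Category.id_comp, Category.assoc, cancel_epi] at h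
  exact h.symm

end Aux

namespace Alg

variable {M : Type u} [Category.{v} M] [MonoidalCategory M] [SymmetricCategory M]
variable {C : Type v} [SmallCategory C] {perp : OrthRel C} (A : Alg M perp)
variable {ι : Type} {c : ι → C} {a t : C}

/-- The action of a morphism. -/
def mapHom (f : a ⟶ t) : A.obj a ⟶ A.obj t :=
  (ρ_ (A.obj a)).inv ≫ A.actId fun _ : Fin 1 => f

/-- The unit of the monoid `A.obj t`. -/
def oneHom (t : C) : 𝟙_ M ⟶ A.obj t :=
  A.actId fun _ : Fin 0 => 𝟙 t

/-- The multiplication of the monoid `A.obj t`. -/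
def mulHom (t : C) : A.obj t ⊗ A.obj t ⟶ A.obj t :=
  A.obj t ◁ (ρ_ (A.obj t)).inv ≫ A.actId fun _ : Fin 2 => 𝟙 t

lemma actList_nil (f : ∀ i, c i ⟶ t) : A.actList f [] = A.oneHom t := by
  have h : ∀ (c : Fin 0 → C) (f : ∀ i, c i ⟶ t), A.actId f = A.oneHom t := by
    intro c f
    obtain rfl : (fun _ => t) = c := Subsingleton.elim _ _
    obtain rfl : (fun _ => 𝟙 t) = f := Subsingleton.elim _ _
    rfl
  exact (Category.id_comp _).trans (h _ _)

lemma actList_singleton (f : ∀ i, c i ⟶ t) (i : ι) :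
    A.actList f [i] = (ρ_ (A.obj (c i))).hom ≫ A.mapHom (f i) := by
  refine (A.actList_eq f (fun _ : Fin 1 => i) (l := [i]) rfl).trans ?_
  exact (Category.id_comp _).trans (Iso.hom_inv_id_assoc _ _).symm

/-- The case of a single block `l`; the cast absorbs the trailing empty list in `l ++ []`. -/
lemma actList_comp (f : ∀ i, c i ⟶ a) (g : a ⟶ t) (l : List ι) :
    A.actList (fun i => f i ≫ g) l = A.actList f l ≫ A.mapHom g := by
  have h := A.actList_flatLists (fun _ : Fin 1 => l) f g
  rw [A.actList_congr _ (List.append_nil l).symm]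
  refine (congrArg (_ ≫ ·) h).trans ?_
  refine append_nil_tensor_aux _ _ _ _ _ (tensAppend_nil _ l) ?_
  exact (eqToHom_trans_assoc _ _ _).trans (Category.id_comp _)

/-- The case of two blocks with outer operation `(𝟙, 𝟙)`, whose action is the multiplication. -/
lemma actList_append (f : ∀ i, c i ⟶ t) (l l' : List ι) :
    A.actList f (l ++ l') = (tensAppend (fun i => A.obj (c i)) l l').hom ≫
      (A.actList f l ⊗ₘ A.actList f l') ≫ A.mulHom t := by
  have h := A.actList_flatLists ![l, l'] f (𝟙 t)
  simp only [Category.comp_id] at h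
  have e : l ++ l' = l ++ (l' ++ []) := by rw [List.append_nil]
  rw [A.actList_congr _ e]
  refine (congrArg (_ ≫ ·) h).trans ?_
  exact append_append_nil_tensor_aux _ _ _ _ _ _ _ _ _ _ (tensAppend_nil _ l')
    (tensCast_tensAppend (by rw [List.append_nil]) rfl) rfl
    ((eqToHom_trans _ _).trans rfl)

lemma mapHom_id (t : C) : A.mapHom (𝟙 t) = 𝟙 (A.obj t) := by
  exact (congrArg (_ ≫ ·) (A.act_one t)).trans (Iso.inv_hom_id _)

lemma mapHom_comp {b : C} (f : b ⟶ a) (g : a ⟶ t) :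
    A.mapHom (f ≫ g) = A.mapHom f ≫ A.mapHom g := by
  have h := A.actList_comp (fun _ : Unit => f) g [()]
  rw [actList_singleton, actList_singleton] at h
  exact (cancel_epi _).mp (h.trans (Category.assoc _ _ _))

lemma oneHom_mapHom (g : a ⟶ t) : A.oneHom a ≫ A.mapHom g = A.oneHom t := by
  have h := A.actList_comp (fun _ : Unit => 𝟙 a) g []
  rw [actList_nil, actList_nil] at h
  exact h.symm

lemma actList_cons (f : ∀ i, c i ⟶ t) (i : ι) (l : List ι) :
    A.actList f (i :: l) = (A.mapHom (f i) ⊗ₘ A.actList f l) ≫ A.mulHom t := by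
  have h := A.actList_append f [i] l
  rw [actList_singleton] at h
  exact h.trans (cons_tensor_aux _ _ _)

lemma actList_singleton_id (t : C) :
    A.actList (fun _ : Unit => 𝟙 t) [()] = (ρ_ (A.obj t)).hom := by
  rw [actList_singleton, mapHom_id]
  exact Category.comp_id _

lemma actList_pair_id (t : C) :
    A.actList (fun _ : Unit => 𝟙 t) [(), ()] =
      (𝟙 (A.obj t) ⊗ₘ (ρ_ (A.obj t)).hom) ≫ A.mulHom t := by
  rw [actList_cons, actList_singleton_id, mapHom_id]
  rfl

/-- The monoid structure of `A.obj t`. -/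
@[reducible] def monObj (t : C) : MonObj (A.obj t) where
  one := A.oneHom t
  mul := A.mulHom t
  one_mul := by
    have h := A.actList_append (fun _ : Unit => 𝟙 t) [] [()]
    rw [actList_nil] at h
    erw [actList_singleton_id] at h
    exact one_mul_aux _ _ h
  mul_one := by
    have h := A.actList_cons (fun _ : Unit => 𝟙 t) () []
    rw [actList_nil, actList_singleton_id, mapHom_id] at h
    exact ((congrArg (· ≫ _) (id_tensorHom _ _)).symm.trans h.symm)
  mul_assoc := by
    -- The threefold product is computed by splitting the list after two entries and after one.
    have h := A.actList_append (fun _ : Unit => 𝟙 t) [(), ()] [()]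
    rw [actList_singleton_id] at h
    have h' := A.actList_cons (fun _ : Unit => 𝟙 t) () [(), ()]
    rw [mapHom_id] at h'
    exact mul_assoc_aux _ _ _ (A.actList_pair_id t) h' h

/-- The monoid `A.obj t`. -/
abbrev mon (t : C) : Mon M := @Mon.mk _ _ _ (A.obj t) (A.monObj t)

lemma mulHom_mapHom (g : a ⟶ t) :
    A.mulHom a ≫ A.mapHom g = (A.mapHom g ⊗ₘ A.mapHom g) ≫ A.mulHom t := by
  have h := A.actList_comp (fun _ : Unit => 𝟙 a) g [(), ()]
  rw [actList_cons, actList_singleton, actList_pair_id, Category.id_comp] at h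
  exact mul_map_aux _ _ _ h

/-- The diagram of monoids underlying an algebra. -/
def diagram : C ⥤ Mon M where
  obj t := A.mon t
  map g := @Mon.Hom.mk' _ _ _ (A.mon _) (A.mon _) (A.mapHom g)
    (A.oneHom_mapHom g) (A.mulHom_mapHom g)
  map_id t := by
    ext
    exact A.mapHom_id t
  map_comp f g := by
    ext
    exact A.mapHom_comp f g

/-- Peeling off one input at a time shows that the maps of the diagram and its monoid structures
determine every operation with trivial permutation. -/
lemma actList_eq_tensProd (f : ∀ i, c i ⟶ t) (l : List ι) :
    A.actList f l = tensProd (fun i => (A.diagram.map (f i)).hom) l := by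
  induction l with
  | nil => exact A.actList_nil f
  | cons i l ih =>
    rw [actList_cons, ih]
    rfl

/-- An operation acts by rearrangement of the factors, followed by the action of an operation with
trivial permutation. -/
lemma act_mk_eq {n : ℕ} {c : Fin n → C} (o : PreOp c t) {l : List (Fin n)}
    (h : (List.finRange n).map o.perm.symm = l) (w : Rearr (List.finRange n) l) :
    A.act (Op.mk perp o) = w.braid (fun i => A.obj (c i)) ≫ A.actList o.hom l := by
  subst h
  have h := A.act_permute (Op.mk perp o) o.perm.symm w
  have e : o.permute o.perm.symm = ⟨1, fun i => o.hom (o.perm.symm i)⟩ :=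
    PreOp.ext (mul_inv_cancel o.perm) rfl
  rw [Op.permute_mk, e] at h
  rw [A.actList_eq o.hom o.perm.symm rfl, ← h, braidPerm, tensReindex_hom]
  exact Category.assoc _ _ _

/-- Equivariance reduces a general operation to one with trivial permutation, so an algebra is
recovered from its diagram. -/
lemma act_mk_eq_eval {n : ℕ} {c : Fin n → C} (o : PreOp c t) :
    A.act (Op.mk perp o) = o.eval A.diagram := by
  rw [A.act_mk_eq o rfl (Rearr.nonempty_of_perm (perm_map_finRange o.perm.symm)).some,
    actList_eq_tensProd]
  rfl

/-- For orthogonal `f₁`, `f₂` the binary operations `[e, f]` and `[swap, f]` coincide. They act by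
the two orders of multiplication, which therefore agree. -/
lemma perpCommuting_diagram : PerpCommuting perp A.diagram := by
  have key : ∀ (c : Fin 2 → C) (t : C) (f : ∀ i, c i ⟶ t), perp.rel (f 0) (f 1) →
      Commuting (A.diagram.map (f 0)).hom (A.diagram.map (f 1)).hom := by
    intro c t f h
    have hs : Op.mk perp (⟨1, f⟩ : PreOp c t) = Op.mk perp ⟨Equiv.swap 0 1, f⟩ :=
      Op.mk_eq_mk.mpr (Relation.ReflTransGen.single ⟨rfl, 0, 1, rfl, h, rfl⟩)
    have h₁ := A.act_mk_eq (⟨1, f⟩ : PreOp c t) (l := [0, 1]) rfl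
      (.cons 0 (.cons 1 .nil))
    have h₂ := A.act_mk_eq (⟨Equiv.swap 0 1, f⟩ : PreOp c t) (l := [1, 0]) rfl (.swap 0 1 [])
    rw [hs, h₂, actList_eq_tensProd, actList_eq_tensProd] at h₁
    exact commuting_aux _ _ h₁
  intro c₁ c₂ t f₁ f₂ h
  exact key ![c₁, c₂] t (Fin.cons f₁ (Fin.cons f₂ fun i => i.elim0)) h

end Alg

/-! ### Restriction and its left adjoint -/

section EvalNaturality

variable {M : Type u} [Category.{v} M] [MonoidalCategory M] [SymmetricCategory M]
variable {C : Type v} [SmallCategory C] {F G : C ⥤ Mon M}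

/-- Naturality of the braiding moves `α` past the rearrangement, and monoid homomorphisms preserve
products. -/
lemma PreOp.eval_naturality (α : F ⟶ G) {n : ℕ} {c : Fin n → C} {t : C} (o : PreOp c t) :
    o.eval F ≫ (α.app t).hom = tensFinMap (fun i => (α.app (c i)).hom) ≫ o.eval G := by
  obtain ⟨w⟩ := Rearr.nonempty_of_perm (perm_map_finRange o.perm.symm)
  rw [o.eval_eq rfl w, o.eval_eq rfl w]
  have e : (fun i => (F.map (o.hom i)).hom ≫ (α.app t).hom) =
      fun i => (α.app (c i)).hom ≫ (G.map (o.hom i)).hom := by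
    funext i
    rw [← Mon.comp_hom', ← Mon.comp_hom', α.naturality]
  have h := tensProd_comp (fun i => (F.map (o.hom i)).hom) (α.app t).hom
    ((List.finRange n).map o.perm.symm)
  rw [e, ← tensMap_tensProd] at h
  have h' := Rearr.braid_naturality (fun i => (α.app (c i)).hom) w
  exact (Category.assoc _ _ _).trans ((congrArg (_ ≫ ·) h).trans
    ((Category.assoc _ _ _).symm.trans ((congrArg (· ≫ _) h').trans (Category.assoc _ _ _))))

end EvalNaturality

section Aux

variable {M : Type u} [Category.{v} M] [MonoidalCategory M]

lemma mapHom_app_aux {A B A' B' : M} (f : A ⊗ 𝟙_ M ⟶ B) (f' : A' ⊗ 𝟙_ M ⟶ B') (p : A ⟶ A')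
    (q : B ⟶ B') (h : f ≫ q = (p ⊗ₘ 𝟙 (𝟙_ M)) ≫ f') :
    ((ρ_ A).inv ≫ f) ≫ q = p ≫ (ρ_ A').inv ≫ f' := by
  rw [Category.assoc, h, tensorHom_id, rightUnitor_inv_naturality_assoc]

lemma mulHom_app_aux {A B : M} (f : A ⊗ (A ⊗ 𝟙_ M) ⟶ A) (g : B ⊗ (B ⊗ 𝟙_ M) ⟶ B) (p : A ⟶ B)
    (h : f ≫ p = (p ⊗ₘ (p ⊗ₘ 𝟙 (𝟙_ M))) ≫ g) :
    (A ◁ (ρ_ A).inv ≫ f) ≫ p = (p ⊗ₘ p) ≫ B ◁ (ρ_ B).inv ≫ g := by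
  rw [Category.assoc, h, ← id_tensorHom, ← id_tensorHom, tensorHom_comp_tensorHom_assoc,
    tensorHom_comp_tensorHom_assoc, tensorHom_id, ← rightUnitor_inv_naturality, Category.id_comp,
    Category.comp_id]

lemma mulHom_algOfDiagram_aux {N : M} [MonObj N] :
    N ◁ (ρ_ N).inv ≫ (𝟙 N ⊗ₘ ((𝟙 N ⊗ₘ MonObj.one) ≫ MonObj.mul)) ≫ MonObj.mul =
      MonObj.mul (X := N) := by
  rw [MonObj.mul_one_hom, ← id_tensorHom, tensorHom_comp_tensorHom_assoc, Iso.inv_hom_id_assoc,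
    Category.id_comp, id_tensorHom_id, Category.id_comp]

end Aux

/-! ### Morphisms of algebras are morphisms of diagrams -/

namespace Alg

variable {M : Type u} [Category.{v} M] [MonoidalCategory M] [SymmetricCategory M]
variable {C : Type v} [SmallCategory C] {perp : OrthRel C} {A B E : Alg M perp}

/-- The morphism of algebras given by a morphism of diagrams of monoids. -/
def homOfDiagram (α : A.diagram ⟶ B.diagram) : A ⟶ B where
  app t := (α.app t).hom
  comm q := by
    obtain ⟨o, rfl⟩ := Op.exists_rep q
    rw [act_mk_eq_eval, act_mk_eq_eval]
    exact o.eval_naturality α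

lemma actId_app (φ : A ⟶ B) {n : ℕ} {c : Fin n → C} {t : C} (f : ∀ i, c i ⟶ t) :
    A.actId f ≫ φ.app t = tensFinMap (fun i => φ.app (c i)) ≫ B.actId f :=
  φ.comm _

lemma mapHom_app (φ : A ⟶ B) {a t : C} (f : a ⟶ t) :
    A.mapHom f ≫ φ.app t = φ.app a ≫ B.mapHom f := by
  have h := actId_app φ fun _ : Fin 1 => f
  exact mapHom_app_aux _ _ _ _ h

lemma mulHom_app (φ : A ⟶ B) (t : C) :
    A.mulHom t ≫ φ.app t = (φ.app t ⊗ₘ φ.app t) ≫ B.mulHom t := by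
  have h := actId_app φ fun _ : Fin 2 => 𝟙 t
  exact mulHom_app_aux _ _ _ h

lemma oneHom_app (φ : A ⟶ B) (t : C) : A.oneHom t ≫ φ.app t = B.oneHom t :=
  (actId_app φ fun _ : Fin 0 => 𝟙 t).trans (Category.id_comp _)

/-- The morphism of diagrams of monoids underlying a morphism of algebras. -/
def diagramMap (φ : A ⟶ B) : A.diagram ⟶ B.diagram where
  app t := @Mon.Hom.mk' _ _ _ (A.mon _) (B.mon _) (φ.app t)
    (oneHom_app φ t) (mulHom_app φ t)
  naturality a t f := by
    ext
    exact mapHom_app φ f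

lemma diagramMap_comp (φ : A ⟶ B) (ψ : B ⟶ E) :
    diagramMap (φ ≫ ψ) = diagramMap φ ≫ diagramMap ψ := rfl

/-- Together with `diagramMap_injective`, this makes the passage from algebras to diagrams fully
faithful. -/
lemma diagramMap_homOfDiagram (α : A.diagram ⟶ B.diagram) : diagramMap (homOfDiagram α) = α := rfl

lemma diagramMap_injective {φ ψ : A ⟶ B} (h : diagramMap φ = diagramMap ψ) : φ = ψ :=
  Hom.ext (funext fun t => congrArg (fun z => (z.app t).hom) h)

/-- A morphism of algebras is an isomorphism if its underlying morphism of diagrams is. -/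
lemma isIso_homOfDiagram (α : A.diagram ⟶ B.diagram) [IsIso α] : IsIso (homOfDiagram α) := by
  refine ⟨homOfDiagram (inv α), ?_, ?_⟩
  · apply Hom.ext
    funext t
    change ((α ≫ inv α).app t).hom = 𝟙 _
    rw [IsIso.hom_inv_id]
    rfl
  · apply Hom.ext
    funext t
    change ((inv α ≫ α).app t).hom = 𝟙 _
    rw [IsIso.inv_hom_id]
    rfl

end Alg

/-! ### Recovering a diagram from its algebra -/

section DiagramOfAlg

variable {M : Type u} [Category.{v} M] [MonoidalCategory M] [SymmetricCategory M]
variable {C : Type v} [SmallCategory C] {perp : OrthRel C} {F : C ⥤ Mon M}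
  (hF : PerpCommuting perp F)

lemma actId_algOfDiagram {n : ℕ} {c : Fin n → C} {t : C} (f : ∀ i, c i ⟶ t) :
    (algOfDiagram hF).actId f = tensProd (fun i => (F.map (f i)).hom) (List.finRange n) := by
  obtain ⟨w, h⟩ := Rearr.exists_refl (fun i => (F.obj (c i)).X) (List.finRange n)
  refine (PreOp.eval_eq ⟨1, f⟩ (List.map_id _) w).trans ?_
  rw [h]
  exact Category.id_comp _

lemma mapHom_algOfDiagram {a t : C} (f : a ⟶ t) :
    (algOfDiagram hF).mapHom f = (F.map f).hom :=
  (congrArg (_ ≫ ·) (actId_algOfDiagram hF fun _ : Fin 1 => f)).trans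
    (rightUnitor_inv_tensor_one_mul (F.map f).hom)

lemma oneHom_algOfDiagram (t : C) : (algOfDiagram hF).oneHom t = (F.obj t).mon.one :=
  actId_algOfDiagram hF fun _ : Fin 0 => 𝟙 t

lemma mulHom_algOfDiagram (t : C) :
    (algOfDiagram hF).mulHom t = (F.obj t).mon.mul := by
  refine (congrArg (_ ≫ ·) (actId_algOfDiagram hF fun _ : Fin 2 => 𝟙 t)).trans ?_
  rw [F.map_id]
  exact mulHom_algOfDiagram_aux (N := (F.obj t).X)

/-- The diagram underlying the algebra of a diagram. -/
noncomputable def diagramOfAlg : F ≅ (algOfDiagram hF).diagram :=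
  NatIso.ofComponents (fun t =>
      Mon.mkIso (N := (algOfDiagram hF).mon t) (Iso.refl (F.obj t).X)
        ((Category.comp_id _).trans (oneHom_algOfDiagram hF t).symm)
        ((Category.comp_id _).trans ((mulHom_algOfDiagram hF t).symm.trans
          ((Category.id_comp _).symm.trans (congrArg (· ≫ _) (id_tensorHom_id _ _).symm)))))
    fun {a t} f => by
      ext
      exact (Category.comp_id _).trans ((mapHom_algOfDiagram hF f).symm.trans
        (Category.id_comp _).symm)

end DiagramOfAlg

/-! ### Restriction of algebras as precomposition of diagrams -/

section Restriction

variable {M : Type u} [Category.{v} M] [MonoidalCategory M] [SymmetricCategory M]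
variable {C D : Type v} [SmallCategory C] [SmallCategory D] {perp : OrthRel D} {j : C ⥤ D}

/-- The diagram underlying the restriction of an algebra. -/
noncomputable def diagramRestriction (A : Alg M perp) :
    ((restriction M perp j).obj A).diagram ≅ j ⋙ A.diagram :=
  -- The two multiplications act by `j.map (𝟙 t)` and by `𝟙 (j.obj t)`, so they agree by
  -- functoriality.
  have h (t : C) : ((restriction M perp j).obj A).mulHom t = A.mulHom (j.obj t) :=
    congrArg (fun f => A.obj (j.obj t) ◁ (ρ_ (A.obj (j.obj t))).inv ≫ A.actId fun _ : Fin 2 => f)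
      (j.map_id t)
  NatIso.ofComponents (fun t =>
      Mon.mkIso (M := ((restriction M perp j).obj A).mon t)
        (N := A.mon (j.obj t)) (Iso.refl (A.obj (j.obj t)))
        ((Category.comp_id _).trans (congrArg (fun f => A.actId fun _ : Fin 0 => f) (j.map_id t)))
        ((Category.comp_id _).trans ((h t).trans
          ((Category.id_comp _).symm.trans (congrArg (· ≫ _) (id_tensorHom_id _ _).symm)))))
    fun {a t} f => by
      ext
      exact (Category.comp_id _).trans (Category.id_comp _).symm

lemma diagramMap_restriction {A A' : Alg M perp} (φ : A ⟶ A') :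
    Alg.diagramMap ((restriction M perp j).map φ) ≫ (diagramRestriction A').hom =
      (diagramRestriction A).hom ≫ Functor.whiskerLeft j (Alg.diagramMap φ) := by
  ext t
  exact (Category.comp_id _).trans (Category.id_comp _).symm

end Restriction

/-! ### The left adjoint and the unit of an arbitrary adjunction -/

section Adjoint

variable {M : Type u} [Category.{v} M] [MonoidalCategory M] [SymmetricCategory M]
  [MonoidalClosed M] [HasColimits M]
variable {C D : Type v} [SmallCategory C] [SmallCategory D] (perp : OrthRel D) (j : C ⥤ D)

variable {perp j} in
/-- The left adjoint of the restriction functor on objects. -/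
noncomputable def leftExtension (B : Alg M (perp.pullback j)) : Alg M perp :=
  algOfDiagram (perpCommuting_ext perp j B.diagram)

variable {perp j} in
/-- The diagram underlying the left extension. -/
noncomputable def diagramLeftExtension (B : Alg M (perp.pullback j)) :
    ext perp j B.diagram ≅ (leftExtension B).diagram :=
  diagramOfAlg (perpCommuting_ext perp j B.diagram)

variable {perp j} in
/-- The underlying morphism of diagrams of the unit. -/
noncomputable def leftExtensionUnitDiagram (B : Alg M (perp.pullback j)) :
    B.diagram ⟶ ((restriction M perp j).obj (leftExtension B)).diagram :=
  extUnit perp j B.diagram ≫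
    Functor.whiskerLeft j (diagramLeftExtension B).hom ≫
      (diagramRestriction (leftExtension B)).inv

/-- The unit of the left extension. -/
noncomputable def leftExtensionUnit (B : Alg M (perp.pullback j)) :
    B ⟶ (restriction M perp j).obj (leftExtension B) :=
  Alg.homOfDiagram (leftExtensionUnitDiagram B)

lemma isIso_leftExtensionUnit [j.Full] [j.Faithful] (B : Alg M (perp.pullback j)) :
    IsIso (leftExtensionUnit perp j B) := by
  have := isIso_extUnit (j := j) (perp := perp) B.perpCommuting_diagram
  have : IsIso (leftExtensionUnitDiagram B) := by
    unfold leftExtensionUnitDiagram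
    exact IsIso.comp_isIso' this (IsIso.comp_isIso' inferInstance (Iso.isIso_inv _))
  exact Alg.isIso_homOfDiagram _

/-- Translates factorization through the unit of algebras into factorization through `extUnit`,
where the universal property of `ext` applies. -/
lemma diagramMap_leftExtensionUnit (B : Alg M (perp.pullback j)) {A : Alg M perp}
    (φ : leftExtension B ⟶ A) :
    Alg.diagramMap (leftExtensionUnit perp j B ≫ (restriction M perp j).map φ) ≫
        (diagramRestriction A).hom =
      extUnit perp j B.diagram ≫ Functor.whiskerLeft j
        ((diagramLeftExtension B).hom ≫ Alg.diagramMap φ) := by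
  rw [Alg.diagramMap_comp, Category.assoc, diagramMap_restriction, leftExtensionUnit,
    Alg.diagramMap_homOfDiagram, leftExtensionUnitDiagram, Category.assoc, Category.assoc,
    Iso.inv_hom_id_assoc, Functor.whiskerLeft_comp]

/-- The universal property of the unit of the left extension. -/
noncomputable def isInitialLeftExtensionUnit (B : Alg M (perp.pullback j)) :
    IsInitial (StructuredArrow.mk (leftExtensionUnit perp j B)) := by
  refine IsInitial.ofUniqueHom (fun Y => StructuredArrow.homMk (Alg.homOfDiagram
    (A := leftExtension B) (B := Y.right)
    ((diagramLeftExtension B).inv ≫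
      extDesc Y.right.perpCommuting_diagram
        (Alg.diagramMap Y.hom ≫ (diagramRestriction _).hom))) ?_) ?_
  · apply Alg.diagramMap_injective
    rw [← cancel_mono (diagramRestriction _).hom]
    refine (diagramMap_leftExtensionUnit perp j B _).trans ?_
    rw [Alg.diagramMap_homOfDiagram, Iso.hom_inv_id_assoc, extUnit_extDesc]
  · intro Y m
    apply StructuredArrow.hom_ext
    apply Alg.diagramMap_injective
    change Alg.diagramMap (A := leftExtension B) m.right = (diagramLeftExtension B).inv ≫ _
    rw [Iso.eq_inv_comp]
    apply ext_natTrans_ext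
    rw [extUnit_extDesc, ← diagramMap_leftExtensionUnit, ← StructuredArrow.w m]
    rfl

lemma isRightAdjoint_restriction : (restriction M perp j).IsRightAdjoint := by
  have (B : Alg M (perp.pullback j)) : HasInitial (StructuredArrow B (restriction M perp j)) :=
    (isInitialLeftExtensionUnit perp j B).hasInitial
  exact isRightAdjointOfStructuredArrowInitials _

variable {perp j} in
-- The unit at `B` of any adjunction and the explicit one are both initial among arrows from `B` to
-- the restriction functor. They differ by the restriction of an isomorphism, and the explicit one
-- is invertible.
lemma isIso_unit [j.Full] [j.Faithful] {L : Alg M (perp.pullback j) ⥤ Alg M perp}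
    (adj : L ⊣ restriction M perp j) : IsIso adj.unit := by
  have (B : Alg M (perp.pullback j)) : IsIso (adj.unit.app B) := by
    let i := (isInitialLeftExtensionUnit perp j B).uniqueUpToIso (mkInitialOfLeftAdjoint _ adj B)
    have h : leftExtensionUnit perp j B ≫ (restriction M perp j).map i.hom.right =
      adj.unit.app B := StructuredArrow.w i.hom
    have := isIso_leftExtensionUnit perp j B
    have : IsIso i.hom.right :=
      inferInstanceAs (IsIso ((StructuredArrow.proj _ _).map i.hom))
    rw [← h]
    infer_instance
  exact NatIso.isIso_of_isIso_app _

/-- In the triangle identity the counit at `L.obj B` composes with the invertible `L.map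
(adj.unit.app B)` to the identity. -/
lemma isIso_counit_app_obj {C D : Type*} [Category* C] [Category* D] {L : C ⥤ D} {R : D ⥤ C}
    (adj : L ⊣ R) [IsIso adj.unit] (B : C) : IsIso (adj.counit.app (L.obj B)) := by
  have h := adj.left_triangle_components B
  exact IsIso.of_isIso_fac_left h

end Adjoint

end OrthQFT

theorem proposition5p5
    {M : Type u} [Category.{v} M] [MonoidalCategory M] [SymmetricCategory M] [MonoidalClosed M]
    [HasLimits M] [HasColimits M]
    {C D : Type v} [SmallCategory C] [SmallCategory D]
    (perp : OrthQFT.OrthRel D) (j : C ⥤ D) [j.Full] [j.Faithful]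
    (hj : Function.Injective j.obj) :
    (OrthQFT.restriction M perp j).IsRightAdjoint ∧
    ∀ (L : OrthQFT.Alg M (perp.pullback j) ⥤ OrthQFT.Alg M perp)
      (adj : L ⊣ OrthQFT.restriction M perp j),
      IsIso adj.unit ∧
      ∃ h : ∀ B, OrthQFT.jLocal adj (L.obj B),
        IsIso (OrthQFT.restrictedAdjunction adj h).unit ∧
        IsIso (OrthQFT.restrictedAdjunction adj h).counit := by
  refine ⟨OrthQFT.isRightAdjoint_restriction perp j, fun L adj => ?_⟩
  have hu := OrthQFT.isIso_unit adj
  refine ⟨hu, OrthQFT.isIso_counit_app_obj adj, ?_, ?_⟩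
  · have : ∀ B, IsIso ((OrthQFT.restrictedAdjunction adj
        (OrthQFT.isIso_counit_app_obj adj)).unit.app B) := fun B =>
      inferInstanceAs (IsIso (adj.unit.app B))
    exact NatIso.isIso_of_isIso_app _
  · have : ∀ A, IsIso ((OrthQFT.restrictedAdjunction adj
        (OrthQFT.isIso_counit_app_obj adj)).counit.app A) := by
      intro A
      -- After inclusion into all algebras this component is the original counit at `A`, whose
      -- invertibility is the meaning of locality; a full subcategory inclusion reflects
      -- isomorphisms.
      have : IsIso ((OrthQFT.jLocal adj).ι.map ((OrthQFT.restrictedAdjunction adj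
        (OrthQFT.isIso_counit_app_obj adj)).counit.app A)) := A.property
      exact isIso_of_reflects_iso _ (OrthQFT.jLocal adj).ι
    exact NatIso.isIso_of_isIso_app _
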